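/- Let $q>1$ be a prime power, $N\ge 1$, let $U_N(\mathbb{F}_q)$ be the group of upper triangular $N\times N$ matrices over $\mathbb{F}_q$ with ones on the diagonal, and let $\mathfrak{u}_N(\mathbb{F}_q)$ be the algebra of strictly upper triangular matrices, with coordinate functionals $e_{ij}^*(X)=X_{ij}$. A character $\chi$ of a finite group $G$ is called Heisenberg if it is a complex irreducible character with $\ker\chi\supseteq[G,[G,G]]$. Binomial coefficients $\binom{m}{k}$ are zero unless $0\le k\le m$. (1) For all integers $n\ge 1$ and $e\ge 0$, the number of Heisenberg characters of $U_{n+1}(\mathbb{F}_q)$ of degree $q^e$ is $$q^{n-e-1}\left(\binom{n-e}{e}(q-1)^e+\binom{n-e-1}{e}(q-1)^{e+1}\right)$$ (read as $0$ if both binomial coefficients are zero). (2) Let $n\ge 0$. Consider lattice paths $P=(s_1,\dots,s_r)$ that start at the origin, end on the line $x+y=n$, do not begin with the step $(0,2)$, and whose steps are $(1,0)$ without label, $(1,1)$ and $(0,1)$ each with one label $t\in\mathbb{F}_q^\times$, and $(0,2)$ with two labels $t,v\in\mathbb{F}_q^\times$. Put $\lambda_P=\lambda_{P,1}+\dots+\lambda_{P,r}\in\mathfrak{u}_{n+1}(\mathbb{F}_q)^*$,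 where, if the $k$th step starts on the line $x+y=i-1$, the functional $\lambda_{P,k}$ is $0$, $t\,e_{i,i+2}^*$, $t\,e_{i,i+1}^*$, or $t\,e_{i-1,i+1}^*+v\,e_{i,i+2}^*$ according as the step is $(1,0)$, $(1,1)$, $(0,1)$ or $(0,2)$. For $\lambda\in\mathfrak{u}_{n+1}(\mathbb{F}_q)^*$ put $\mathfrak{l}^0=0$, $\mathfrak{s}^0=\mathfrak{u}_{n+1}(\mathbb{F}_q)$, $\mathfrak{l}^{i+1}=\{X\in\mathfrak{s}^i:\lambda(XY)=0\ \forall Y\in\mathfrak{s}^i\}$, $\mathfrak{s}^{i+1}=\{X\in\mathfrak{s}^i:\lambda(XY)=0\ \forall Y\in\mathfrak{l}^{i+1}\}$, and $\bar{L}_\lambda=1+\bigcup_i\mathfrak{l}^i$, a subgroup of $U_{n+1}(\mathbb{F}_q)$. Fix a nontrivial homomorphism $\theta:\mathbb{F}_q^+\to\mathbb{C}^\times$ and let $\xi_P$ be the character of $U_{n+1}(\mathbb{F}_q)$ induced from the character $g\mapsto\theta(\lambda_P(g-1))$ of $\bar{L}_{\lambda_P}$. Then $\xi_P$ is a Heisenberg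 character and has degree $\xi_P(1)=q^{k+\ell}$, where $k$ and $\ell$ are the numbers of steps $(1,1)$ and $(0,2)$ in $P$. (3) For every $n\ge 1$ there is a polynomial in one variable with nonnegative integer coefficients, depending only on $n$, of degree $n$ and with leading coefficient the $n$th Fibonacci number $f_n$ (where $f_1=f_2=1$, $f_{m+2}=f_{m+1}+f_m$), whose value at $q-1$ is the total number of Heisenberg characters of $U_{n+1}(\mathbb{F}_q)$ for every prime power $q>1$. -/

import Mathlib

open Polynomial

universe u

namespace HeisenbergUnitriangular

/-! ## Characters of finite groups -/

/-- `χ : G → ℂ` is the character of an irreducible (finite-dimensional) complex representation. -/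
def IsIrreducibleCharacter {G : Type*} [Group G] (χ : G → ℂ) : Prop :=
  ∃ (V : Type) (_ : AddCommGroup V) (_ : Module ℂ V) (_ : FiniteDimensional ℂ V)
    (ρ : Representation ℂ G V), ρ.IsIrreducible ∧ ρ.character = χ

/-- `χ` is a Heisenberg character of `G`: it is an irreducible character, and its kernel
`{g | χ g = χ 1}` contains `[G, [G, G]]`. -/
def IsHeisenberg {G : Type*} [Group G] (χ : G → ℂ) : Prop :=
  IsIrreducibleCharacter χ ∧
    ∀ g ∈ ⁅(⊤ : Subgroup G), ⁅(⊤ : Subgroup G), (⊤ : Subgroup G)⁆⁆, χ g = χ 1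

open Classical in
/-- The class function of the finite group `G` induced from a function `φ` on the subgroup `H`
(`φ` is used only on `H`):
`g ↦ |H|⁻¹ ∑_{x ∈ G, x g x⁻¹ ∈ H} φ (x g x⁻¹)`. -/
noncomputable def inducedCharacter {G : Type*} [Group G] (H : Subgroup G) (φ : G → ℂ) :
    G → ℂ :=
  fun g => (Nat.card H : ℂ)⁻¹ *
    ∑ᶠ x : G, if x * g * x⁻¹ ∈ H then φ (x * g * x⁻¹) else 0

/-! ## The subalgebras attached to a functional on an associative algebra -/

section Radicals

set_option linter.unusedSectionVars false

variable {F A : Type*} [Field F] [NonUnitalRing A] [Module F A] [IsScalarTower F A A]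
  [SMulCommClass F A A]

/-- `{X ∈ S | lam (X * Y) = 0 for all Y ∈ T}`. -/
def orthoIn (lam : A →ₗ[F] F) (S T : Submodule F A) : Submodule F A where
  carrier := {X | X ∈ S ∧ ∀ Y ∈ T, lam (X * Y) = 0}
  zero_mem' := ⟨S.zero_mem, fun Y _ => by simp⟩
  add_mem' := fun {a b} ha hb =>
    ⟨S.add_mem ha.1 hb.1, fun Y hY => by simp [add_mul, ha.2 Y hY, hb.2 Y hY]⟩
  smul_mem' := fun c a ha =>
    ⟨S.smul_mem c ha.1, fun Y hY => by simp [smul_mul_assoc, ha.2 Y hY]⟩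

/-- The descending sequence `𝔰⁰ = A`,
`𝔰ⁱ⁺¹ = {X ∈ 𝔰ⁱ | lam (X * Y) = 0 for all Y ∈ 𝔩ⁱ⁺¹}`. -/
def sSeq (lam : A →ₗ[F] F) : ℕ → Submodule F A
  | 0 => ⊤
  | i + 1 => orthoIn lam (sSeq lam i) (orthoIn lam (sSeq lam i) (sSeq lam i))

/-- The ascending sequence `𝔩⁰ = 0`,
`𝔩ⁱ⁺¹ = {X ∈ 𝔰ⁱ | lam (X * Y) = 0 for all Y ∈ 𝔰ⁱ}`. -/
def lSeq (lam : A →ₗ[F] F) : ℕ → Submodule F A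
  | 0 => ⊥
  | i + 1 => orthoIn lam (sSeq lam i) (sSeq lam i)

/-- The union of the ascending chain `𝔩⁰ ⊆ 𝔩¹ ⊆ ⋯`. -/
def lBar (lam : A →ₗ[F] F) : Submodule F A := ⨆ i, lSeq lam i

theorem lSeq_mono (lam : A →ₗ[F] F) : Monotone (lSeq lam) := by
  refine monotone_nat_of_le_succ fun i => ?_
  cases i with
  | zero => exact bot_le
  | succ i =>
    intro X hX
    exact ⟨⟨hX.1, fun Y hY => hX.2 Y hY.1⟩, fun Y hY => hX.2 Y hY.1⟩

theorem sSeq_mul_mem (lam : A →ₗ[F] F) (i : ℕ) :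
    ∀ X ∈ sSeq lam i, ∀ Y ∈ sSeq lam i, X * Y ∈ sSeq lam i := by
  induction i with
  | zero => intro X _ Y _; exact Submodule.mem_top
  | succ i ih =>
    intro X hX X' hX'
    refine ⟨ih X hX.1 X' hX'.1, fun Y hY => ?_⟩
    rw [mul_assoc]
    refine hX.2 _ ⟨ih X' hX'.1 Y hY.1, fun Z hZ => ?_⟩
    rw [mul_assoc]
    refine hX'.2 _ ⟨ih Y hY.1 Z hZ, fun W hW => ?_⟩
    rw [mul_assoc]
    exact hY.2 _ (ih Z hZ W hW)

theorem lSeq_mul_mem (lam : A →ₗ[F] F) (i : ℕ) :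
    ∀ X ∈ lSeq lam i, ∀ Y ∈ lSeq lam i, X * Y ∈ lSeq lam i := by
  cases i with
  | zero =>
    intro X hX Y _
    have h0 : X = 0 := (Submodule.mem_bot F).1 hX
    rw [h0, zero_mul]
    exact Submodule.zero_mem _
  | succ i =>
    intro X hX Y hY
    refine ⟨sSeq_mul_mem lam i X hX.1 Y hY.1, fun Z hZ => ?_⟩
    rw [mul_assoc]
    exact hX.2 _ (sSeq_mul_mem lam i Y hY.1 Z hZ)

theorem lBar_mul_mem (lam : A →ₗ[F] F) {X Y : A} (hX : X ∈ lBar lam) (hY : Y ∈ lBar lam) :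
    X * Y ∈ lBar lam := by
  have hd : Directed (· ≤ ·) (lSeq lam) := (lSeq_mono lam).directed_le
  obtain ⟨i, hi⟩ := (Submodule.mem_iSup_of_directed _ hd).1 hX
  obtain ⟨j, hj⟩ := (Submodule.mem_iSup_of_directed _ hd).1 hY
  refine (Submodule.mem_iSup_of_directed _ hd).2 ⟨max i j, ?_⟩
  exact lSeq_mul_mem lam _ X (lSeq_mono lam (le_max_left i j) hi) Y
    (lSeq_mono lam (le_max_right i j) hj)

end Radicals

/-! ## Unitriangular groups -/

/-- The group `U_N(F)` of upper triangular `N × N` matrices with ones on the diagonal. -/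
def U (N : ℕ) (F : Type*) [Field F] : Subgroup (GL (Fin N) F) where
  carrier := {g | (∀ i j, j < i → (g : Matrix (Fin N) (Fin N) F) i j = 0) ∧
    ∀ i, (g : Matrix (Fin N) (Fin N) F) i i = 1}
  one_mem' := ⟨fun i j h => by simp [h.ne'], fun i => by simp⟩
  mul_mem' := by
    rintro g h ⟨hg, hg1⟩ ⟨hh, hh1⟩
    refine ⟨fun i j hij => ?_, fun i => ?_⟩
    · rw [Units.val_mul, Matrix.mul_apply]
      refine Finset.sum_eq_zero fun k _ => ?_
      rcases lt_or_ge k i with hk | hk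
      · rw [hg i k hk, zero_mul]
      · rw [hh k j (lt_of_lt_of_le hij hk), mul_zero]
    · rw [Units.val_mul, Matrix.mul_apply, Finset.sum_eq_single i, hg1, hh1, one_mul]
      · intro k _ hk
        rcases lt_or_gt_of_ne hk with hk | hk
        · rw [hg i k hk, zero_mul]
        · rw [hh k i hk, mul_zero]
      · simp
  inv_mem' := by
    rintro g ⟨hg, hg1⟩
    have ht : (g : Matrix (Fin N) (Fin N) F).BlockTriangular id := fun i j hij => hg i j hij
    have : Invertible (g : Matrix (Fin N) (Fin N) F) := g.invertible
    have hi : (↑g⁻¹ : Matrix (Fin N) (Fin N) F).BlockTriangular id := by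
      rw [Matrix.coe_units_inv]
      exact Matrix.blockTriangular_inv_of_blockTriangular ht
    refine ⟨fun i j hij => hi hij, fun i => ?_⟩
    have h1 : ((g : Matrix (Fin N) (Fin N) F) * (↑g⁻¹ : Matrix (Fin N) (Fin N) F)) i i = 1 := by
      rw [← Units.val_mul, mul_inv_cancel]; simp
    rw [Matrix.mul_apply, Finset.sum_eq_single i, hg1, one_mul] at h1
    · exact h1
    · intro k _ hk
      rcases lt_or_gt_of_ne hk with hk | hk
      · rw [hg i k hk, zero_mul]
      · rw [hi hk, mul_zero]
    · simp

/-- The algebra `𝔲_N(F)` of strictly upper triangular `N × N` matrices. -/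
def nilU (N : ℕ) (F : Type*) [Field F] : NonUnitalSubalgebra F (Matrix (Fin N) (Fin N) F) where
  carrier := {X | ∀ i j, j ≤ i → X i j = 0}
  zero_mem' := fun i j _ => rfl
  add_mem' := fun {a b} ha hb i j hij => by simp [ha i j hij, hb i j hij]
  smul_mem' := fun c a ha i j hij => by simp [ha i j hij]
  mul_mem' := by
    intro a b ha hb i j hij
    rw [Matrix.mul_apply]
    refine Finset.sum_eq_zero fun k _ => ?_
    rcases le_or_gt k i with hk | hk
    · rw [ha i k hk, zero_mul]
    · rw [hb k j (hij.trans hk.le), mul_zero]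

/-- The bijection `U_N(F) → 𝔲_N(F)`, `g ↦ g - 1`. -/
def subOne {N : ℕ} {F : Type*} [Field F] (g : U N F) : nilU N F :=
  ⟨((g : GL (Fin N) F) : Matrix (Fin N) (Fin N) F) - 1, fun i j hij => by
    rcases hij.lt_or_eq with h | h
    · simp [g.2.1 i j h, h.ne']
    · subst h; simp [g.2.2 j]⟩

theorem subOne_mul {N : ℕ} {F : Type*} [Field F] (g h : U N F) :
    subOne (g * h) = subOne g + subOne h + subOne g * subOne h := by
  apply Subtype.ext
  simp [subOne, sub_mul, mul_sub]
  abel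

theorem subOne_one {N : ℕ} {F : Type*} [Field F] : subOne (1 : U N F) = 0 := by
  apply Subtype.ext
  simp [subOne]

/-- The subgroup `1 + 𝔩̄` of `U_N(F)`. -/
def LBar {N : ℕ} {F : Type*} [Field F] [Finite F] (lam : nilU N F →ₗ[F] F) : Subgroup (U N F) where
  carrier := {g | subOne g ∈ lBar lam}
  one_mem' := by
    change subOne 1 ∈ lBar lam
    rw [subOne_one]; exact Submodule.zero_mem _
  mul_mem' := by
    intro g h hg hh
    change subOne (g * h) ∈ lBar lam
    rw [subOne_mul]
    exact Submodule.add_mem _ (Submodule.add_mem _ hg hh) (lBar_mul_mem lam hg hh)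
  inv_mem' := by
    intro g hg
    have : Finite (U N F) := inferInstance
    have hpow : ∀ k : ℕ, subOne (g ^ k) ∈ lBar lam := by
      intro k
      induction k with
      | zero => rw [pow_zero, subOne_one]; exact Submodule.zero_mem _
      | succ k ih =>
        rw [pow_succ, subOne_mul]
        exact Submodule.add_mem _ (Submodule.add_mem _ ih hg) (lBar_mul_mem lam ih hg)
    have hinv : g⁻¹ = g ^ (orderOf g - 1) := by
      rw [inv_eq_iff_mul_eq_one, mul_pow_sub_one (orderOf_pos g).ne', pow_orderOf_eq_one]
    change subOne g⁻¹ ∈ lBar lam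
    rw [hinv]
    exact hpow _

/-- The function `g ↦ θ (lam (g - 1))` on `U_N(F)`. -/
def thetaFun {N : ℕ} {F : Type*} [Field F] (θ : AddChar F ℂ) (lam : nilU N F →ₗ[F] F) :
    U N F → ℂ :=
  fun g => θ (lam (subOne g))

/-- The character `ξ_lam` of `U_N(F)`, induced from the linear character `g ↦ θ (lam (g - 1))`
of the subgroup `1 + 𝔩̄`. -/
noncomputable def xi {N : ℕ} {F : Type*} [Field F] [Finite F] (θ : AddChar F ℂ)
    (lam : nilU N F →ₗ[F] F) : U N F → ℂ :=
  inducedCharacter (LBar lam) (thetaFun θ lam)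

/-! ## Labelled lattice paths -/

/-- The steps `(1,0)`, `(1,1)`, `(0,1)`, `(0,2)`, each carrying as many nonzero labels as its
height. -/
inductive Step (F : Type*) [Field F]
  | right : Step F
  | diag (t : Fˣ) : Step F
  | up (t : Fˣ) : Step F
  | upup (t v : Fˣ) : Step F

/-- The underlying vector of a step. -/
def Step.vec {F : Type*} [Field F] : Step F → ℕ × ℕ
  | .right => (1, 0)
  | .diag _ => (1, 1)
  | .up _ => (0, 1)
  | .upup _ _ => (0, 2)

/-- Whether a step is `(1,1)`. -/
def Step.isDiag {F : Type*} [Field F] : Step F → Bool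
  | .diag _ => true
  | _ => false

/-- Whether a step is `(0,2)`. -/
def Step.isUpup {F : Type*} [Field F] : Step F → Bool
  | .upup _ _ => true
  | _ => false

/-- The endpoint of the path that starts at the origin and takes the given steps. -/
def endpoint {F : Type*} [Field F] (P : List (Step F)) : ℕ × ℕ := (P.map Step.vec).sum

/-- The labelled lattice paths that end on the line `x + y = n` and do not begin with the
step `(0,2)`. -/
def HeisPaths (n : ℕ) (F : Type*) [Field F] : Set (List (Step F)) :=
  {P | (endpoint P).1 + (endpoint P).2 = n ∧ ∀ t v, P.head? ≠ some (Step.upup t v)}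

/-- The coordinate functional `X ↦ X i j` on `𝔲_N(F)`, rows and columns numbered from `0`
(and the zero functional if `i` or `j` is out of range). -/
def eStar {N : ℕ} {F : Type*} [Field F] (i j : ℕ) : nilU N F →ₗ[F] F where
  toFun X := if h : i < N ∧ j < N then (X : Matrix (Fin N) (Fin N) F) ⟨i, h.1⟩ ⟨j, h.2⟩ else 0
  map_add' X Y := by split_ifs <;> simp
  map_smul' c X := by split_ifs <;> simp

/-- The functional of a step that starts on the line `x + y = d`. Rows and columns are numbered
from `0`, so `d` stands for the index `i = d + 1` of the usual numbering from `1`; a step `(0,2)` is not the first step of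
the paths considered, so `1 ≤ d` in the last case. -/
def stepFunctional {N : ℕ} {F : Type*} [Field F] (d : ℕ) : Step F → (nilU N F →ₗ[F] F)
  | .right => 0
  | .up t => (t : F) • eStar d (d + 1)
  | .diag t => (t : F) • eStar d (d + 2)
  | .upup t v => (t : F) • eStar (d - 1) (d + 1) + (v : F) • eStar d (d + 2)

/-- The sum of the functionals of the steps of a path that starts on the line `x + y = d`. -/
def functionalFrom {N : ℕ} {F : Type*} [Field F] : ℕ → List (Step F) → (nilU N F →ₗ[F] F)
  | _, [] => 0
  | d, s :: P => stepFunctional d s + functionalFrom (d + (s.vec.1 + s.vec.2)) P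

/-- The functional `lam_P` on `𝔲_N(F)` of a path `P` from the origin. -/
def pathFunctional (N : ℕ) {F : Type*} [Field F] (P : List (Step F)) : nilU N F →ₗ[F] F :=
  functionalFrom 0 P

/-- The character `ξ_P` of `U_N(F)`. -/
noncomputable def xiPath (N : ℕ) {F : Type*} [Field F] [Finite F] (θ : AddChar F ℂ)
    (P : List (Step F)) : U N F → ℂ :=
  xi θ (pathFunctional N P)

end HeisenbergUnitriangular

/-! By `commutator_eq_lowerSubgroup_two`, a Heisenberg character sees only the first two
superdiagonals. Modulo the third term of the lower central series the second superdiagonal is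
central, so by Schur's lemma it acts through `θ (∑ cᵢ gᵢ,ᵢ₊₂)` for some vector `c`. A commutator of
elements with superdiagonals `x` and `y` then acts by `θ` of the alternating form `∑ cᵢ (xᵢ yᵢ₊₁ -
yᵢ xᵢ₊₁)`.

Elements whose superdiagonal lies in the radical of this form act by scalars, through an additive
character `η` of the radical. Any other element is conjugate to a multiple of itself by a scalar
other than `1`, so the character vanishes there, and having norm one it has degree `q ^ e` with `2 *
e` the rank of the form. Hence Heisenberg characters correspond bijectively to pairs `(c, η)`: see
`isHeisenberg_radicalChar`, `exists_eq_radicalChar` and `radicalChar_injective`.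

To find the rank, mark every other index in each run of nonzero `cᵢ`, starting from the last. The
vectors vanishing at the marked indices form a subspace equal to its own orthogonal
(`orthogonal_unmarked`), so `e` is the number of marked indices. Prepending one entry to `c` gives a
Pascal-type recursion for the number of `c` of given `e` (`cardUnmarked_eq`), and each `c` admits `q
^ (n - 2 * e)` choices of `η`. In the sum over `e` the top coefficient in `q - 1` is a diagonal sum
of binomials, a Fibonacci number.

The functional of a path lives on the first two superdiagonals, and its value on a product `X * Y`
depends only on the superdiagonals of the factors. So `𝔩̄` is the preimage of the self-orthogonal
subspace (`lBar_bandFunctional`), and inducing yields the character of a pair `(c, η)`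
(`xi_bandFunctional`). Each step `(1,1)` or `(0,2)` produces exactly one marked index
(`exists_band_of_path`). -/

namespace HeisenbergUnitriangular

open Module
open scoped commutatorElement

/-! ### Irreducible representations in which a subgroup acts by scalars -/

section RepresentationTheory

variable {G : Type*} [Group G] {V : Type*} [AddCommGroup V] [Module ℂ V]

/-- A representation on a finite-dimensional space in which `Z` acts by the scalars `μ`, transported
to `ℂ ^ d` along a basis. -/
theorem exists_representation_fin [FiniteDimensional ℂ V] (ρ : Representation ℂ G V)
    (Z : Subgroup G) (μ : G → ℂ) (hρ : ∀ z ∈ Z, ρ z = μ z • 1) :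
    ∃ σ : Representation ℂ G (Fin (finrank ℂ V) → ℂ), ∀ z ∈ Z, σ z = μ z • 1 := by
  let e : V ≃ₗ[ℂ] (Fin (finrank ℂ V) → ℂ) := (finBasis ℂ V).equivFun
  refine ⟨⟨⟨fun g => e.conj (ρ g), ?_⟩, ?_⟩, fun z hz => ?_⟩
  · rw [map_one]; exact e.conj_id
  · intro g h
    simp only [map_mul]
    exact e.conj_comp _ _
  · change e.conj (ρ z) = _
    rw [hρ z hz, map_smul]
    congr 1
    exact e.conj_id

/-- A group acting by the scalars `μ` through `Z` on some nonzero finite-dimensional space does so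
on an irreducible one. -/
theorem exists_irreducible_of_scalar [FiniteDimensional ℂ V] [Nontrivial V]
    (ρ : Representation ℂ G V) (Z : Subgroup G) (μ : G → ℂ) (hρ : ∀ z ∈ Z, ρ z = μ z • 1) :
    ∃ (d : ℕ) (σ : Representation ℂ G (Fin d → ℂ)), σ.IsIrreducible ∧ ∀ z ∈ Z, σ z = μ z • 1 := by
  classical
  -- A nonzero space of least dimension with this scalar action is irreducible, because
  -- subrepresentations inherit the action. Using `Fin d → ℂ` lets `Nat.find` choose it and keeps it
  -- in `Type`, as `IsIrreducibleCharacter` requires.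
  let Q : ℕ → Prop := fun d => 0 < d ∧
    ∃ σ : Representation ℂ G (Fin d → ℂ), ∀ z ∈ Z, σ z = μ z • 1
  have hQ : ∃ d, Q d := ⟨_, finrank_pos, exists_representation_fin ρ Z μ hρ⟩
  obtain ⟨hpos, σ, hσ⟩ := Nat.find_spec hQ
  refine ⟨Nat.find hQ, σ, ?_, hσ⟩
  have hbt : (⊥ : Subrepresentation σ) ≠ ⊤ := by
    intro h
    have h1 : (⊥ : Submodule ℂ (Fin (Nat.find hQ) → ℂ)) = ⊤ :=
      congrArg Subrepresentation.toSubmodule h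
    have h2 := finrank_top ℂ (Fin (Nat.find hQ) → ℂ)
    rw [← h1, finrank_bot, finrank_fin_fun] at h2
    omega
  have : Nontrivial (Subrepresentation σ) := ⟨⊥, ⊤, hbt⟩
  refine ⟨fun a => ?_⟩
  by_cases ha : a.toSubmodule = ⊥
  · exact Or.inl (Subrepresentation.toSubmodule_injective ha)
  · right
    apply Subrepresentation.toSubmodule_injective
    change a.toSubmodule = ⊤
    have hfin : 0 < finrank ℂ a.toSubmodule := by
      rw [Nat.pos_iff_ne_zero]
      exact fun h => ha (Submodule.finrank_eq_zero.1 h)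
    have := Nat.find_min' hQ ⟨hfin,
      exists_representation_fin a.toRepresentation Z μ (fun z hz => by
        ext v
        have := LinearMap.congr_fun (hσ z hz) v
        simp [Subrepresentation.toRepresentation, this])⟩
    apply Submodule.eq_top_of_finrank_eq
    refine le_antisymm (Submodule.finrank_le _) ?_
    rw [finrank_fin_fun]; exact this

/-- A `G`-invariant linear character `μ` of a normal subgroup `Z` is the scalar action of `Z` in
some irreducible representation of `G`. -/
theorem exists_irreducible_of_linear [Finite G] (Z : Subgroup G) (μ : G → ℂ) (h1 : μ 1 = 1)
    (hmul : ∀ z ∈ Z, ∀ w ∈ Z, μ (z * w) = μ z * μ w)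
    (hconj : ∀ g, ∀ z ∈ Z, g * z * g⁻¹ ∈ Z ∧ μ (g * z * g⁻¹) = μ z) :
    ∃ (d : ℕ) (σ : Representation ℂ G (Fin d → ℂ)), σ.IsIrreducible ∧ ∀ z ∈ Z, σ z = μ z • 1 := by
  classical
  -- A model of the representation induced from `μ`, with `G` acting by right translation. Since `x
  -- * z = (x * z * x⁻¹) * x`, invariance of `μ` makes `Z` act by scalars; `μ` extended by zero is a
  -- nonzero vector.
  let W : Submodule ℂ (G → ℂ) :=
    { carrier := {f | ∀ z ∈ Z, ∀ g, f (z * g) = μ z * f g}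
      zero_mem' := fun z _ g => by simp
      add_mem' := fun {a b} ha hb z hz g => by simp [ha z hz g, hb z hz g, mul_add]
      smul_mem' := fun c a ha z hz g => by simp [ha z hz g]; ring }
  let τ : Representation ℂ G W :=
    { toFun := fun g => (LinearMap.funLeft ℂ ℂ (fun x : G => x * g)).restrict
        (p := W) (q := W) (fun f hf z hz x => by
          simp only [LinearMap.funLeft_apply, mul_assoc]
          exact hf z hz (x * g))
      map_one' := by ext f x; simp [LinearMap.funLeft_apply]
      map_mul' := fun g h => by ext f x; simp [LinearMap.funLeft_apply, mul_assoc] }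
  have hτ : ∀ z ∈ Z, τ z = μ z • 1 := by
    intro z hz
    ext f x
    have h := f.2 _ (hconj x z hz).1 x
    rw [(hconj x z hz).2] at h
    simpa [τ, LinearMap.funLeft_apply] using h
  have : Nontrivial W := by
    refine ⟨⟨⟨fun g => if g ∈ Z then μ g else 0, fun z hz g => ?_⟩, 0, fun h => ?_⟩⟩
    · by_cases hg : g ∈ Z
      · simp [hg, Z.mul_mem hz hg, hmul z hz g hg]
      · simp [hg, (Z.mul_mem_cancel_left hz)]
    · have := congrFun (congrArg Subtype.val h) 1
      simp [Z.one_mem, h1] at this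
  exact exists_irreducible_of_scalar τ Z μ hτ

/-- Schur's lemma for an endomorphism that commutes with the group. -/
theorem exists_scalar_of_commute [FiniteDimensional ℂ V] (ρ : Representation ℂ G V)
    (hρ : ρ.IsIrreducible) (T : V →ₗ[ℂ] V) (hT : ∀ g, Commute T (ρ g)) : ∃ c : ℂ, T = c • 1 := by
  let f : Representation.IntertwiningMap ρ ρ := ⟨T, fun g => hT g⟩
  obtain ⟨c, hc⟩ :=
    (Representation.IsIrreducible.algebraMap_intertwiningMap_bijective_of_isAlgClosed (ρ := ρ)).2 f
  refine ⟨c, ?_⟩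
  have := congrArg Representation.IntertwiningMap.toLinearMap hc
  rw [Representation.IntertwiningMap.algebraMap_apply] at this
  exact this.symm

theorem nontrivial_of_isIrreducible (ρ : Representation ℂ G V) (hρ : ρ.IsIrreducible) :
    Nontrivial V := by
  by_contra h
  rw [not_nontrivial_iff_subsingleton] at h
  refine bot_ne_top (α := Subrepresentation ρ) ?_
  apply Subrepresentation.toSubmodule_injective
  exact Subsingleton.elim _ _

/-- Where the character takes the value at `1`, the representation is trivial. -/
theorem apply_eq_one_of_character [Finite G] [FiniteDimensional ℂ V] (ρ : Representation ℂ G V)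
    (N : Subgroup G) (hN : ∀ g ∈ N, ρ.character g = ρ.character 1) : ∀ g ∈ N, ρ g = 1 := by
  classical
  have := Fintype.ofFinite N
  -- The average of the character over `N` is the dimension of the `N`-invariants; here it is also
  -- the dimension of `V`.
  let σ : Representation ℂ N V := ρ.comp N.subtype
  have hne : (Nat.card N : ℂ) ≠ 0 := by exact_mod_cast Nat.card_pos.ne'
  have : Invertible (Nat.card N : ℂ) := invertibleOfNonzero hne
  have h := Representation.card_inv_mul_sum_char_eq_finrank σ
  have hs : ∑ g : N, σ.character g = Nat.card N * finrank ℂ V := by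
    have hc : ∀ g : N, σ.character g = finrank ℂ V := fun g =>
      (hN g.1 g.2).trans (Representation.char_one ρ)
    simp [hc, Nat.card_eq_fintype_card]
  rw [hs, inv_mul_cancel_left₀ hne] at h
  have htop : σ.invariants = ⊤ := Submodule.eq_top_of_finrank_eq (by exact_mod_cast h.symm)
  intro g hg
  ext v
  have hv : v ∈ σ.invariants := htop ▸ Submodule.mem_top
  exact (Representation.mem_invariants σ v).1 hv ⟨g, hg⟩

open Classical in
/-- The character of an irreducible representation in which `Z` acts by the scalars `μ` and every
element outside `Z` is moved by a conjugation to a different scalar multiple of itself. -/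
theorem character_of_scalar [Finite G] [FiniteDimensional ℂ V] (ρ : Representation ℂ G V)
    (hρ : ρ.IsIrreducible) (Z : Subgroup G) (μ : G → ℂ) (hZ : ∀ z ∈ Z, ρ z = μ z • 1)
    (hsep : ∀ g ∉ Z, ∃ h, ∃ z ∈ Z, h * g * h⁻¹ = z * g ∧ μ z ≠ 1) :
    (∀ g, ρ.character g = if g ∈ Z then (finrank ℂ V : ℂ) * μ g else 0) ∧
      finrank ℂ V ^ 2 * Nat.card Z = Nat.card G := by
  have := nontrivial_of_isIrreducible ρ hρ
  have := Fintype.ofFinite G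
  have hd : (finrank ℂ V : ℂ) ≠ 0 := by exact_mod_cast (finrank_pos (R := ℂ) (M := V)).ne'
  have hchar : ∀ g, ρ.character g = if g ∈ Z then (finrank ℂ V : ℂ) * μ g else 0 := by
    intro g
    split_ifs with hg
    · simp [Representation.character, hZ g hg, mul_comm]
    · obtain ⟨h, z, hz, hzg, hμ⟩ := hsep g hg
      have h1 := Representation.char_conj ρ g h
      rw [hzg] at h1
      have h2 : ρ.character (z * g) = μ z * ρ.character g := by
        simp [Representation.character, hZ z hz]
      rw [h2] at h1
      have h3 : (μ z - 1) * ρ.character g = 0 := by rw [sub_mul, h1]; ring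
      exact (mul_eq_zero.1 h3).resolve_left (sub_ne_zero.2 hμ)
  refine ⟨hchar, ?_⟩
  have hne : (Nat.card G : ℂ) ≠ 0 := by exact_mod_cast Nat.card_pos.ne'
  have : Invertible (Nat.card G : ℂ) := invertibleOfNonzero hne
  -- The character is supported on `Z`, where each term of its norm is the square of the dimension;
  -- norm one gives the second claim.
  have horth := Representation.char_orthonormal ρ ρ
  rw [if_pos ⟨Representation.Equiv.refl ρ⟩, inv_mul_eq_iff_eq_mul₀ hne, mul_one] at horth
  have hterm : ∀ g, ρ.character g * ρ.character g⁻¹ =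
      if g ∈ Z then (finrank ℂ V : ℂ) ^ 2 else 0 := by
    intro g
    rw [hchar, hchar, inv_mem_iff]
    split_ifs with hg
    · have h1 : ρ.character (g * g⁻¹) = finrank ℂ V * (μ g * μ g⁻¹) := by
        rw [Representation.character, map_mul, hZ g hg, hZ _ (Z.inv_mem hg)]
        simp
        ring
      rw [mul_inv_cancel, Representation.char_one] at h1
      have h2 : μ g * μ g⁻¹ = 1 := by
        apply mul_left_cancel₀ hd
        rw [← h1, mul_one]
      linear_combination (finrank ℂ V : ℂ) ^ 2 * h2
    · simp
  rw [Finset.sum_congr rfl (fun g _ => hterm g), ← Finset.sum_filter, Finset.sum_const,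
    nsmul_eq_mul] at horth
  have hc : (Finset.univ.filter (fun g => g ∈ Z)).card = Nat.card Z := by
    rw [Nat.card_eq_fintype_card, Fintype.card_subtype]
  rw [hc] at horth
  have : ((Nat.card Z * finrank ℂ V ^ 2 : ℕ) : ℂ) = (Nat.card G : ℕ) := by
    push_cast; exact horth
  rw [mul_comm]
  exact_mod_cast this

end RepresentationTheory

/-! ### Rank and radical of the alternating form, by marking indices -/

section AlternatingForm

variable {F : Type*} [Field F] {n : ℕ}

/-- Extension by zero of a vector of length `n` to a sequence. -/
def extendZero : (Fin n → F) →ₗ[F] (ℕ → F) where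
  toFun r i := if h : i < n then r ⟨i, h⟩ else 0
  map_add' r s := by ext i; by_cases h : i < n <;> simp [h]
  map_smul' a r := by ext i; by_cases h : i < n <;> simp [h]

theorem extendZero_apply_fin (r : Fin n → F) (i : Fin n) : extendZero r i = r i := by
  simp [extendZero]

theorem extendZero_of_le (r : Fin n → F) {i : ℕ} (h : n ≤ i) : extendZero r i = 0 := by
  simp [extendZero, h.not_gt]

theorem extendZero_single (j : Fin n) (i : ℕ) :
    extendZero (Pi.single j (1 : F)) i = if i = j then 1 else 0 := by
  by_cases h : i < n
  · simp [extendZero, h, Pi.single_apply, Fin.ext_iff]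
  · have : i ≠ j := fun h' => h (h' ▸ j.2)
    simp [extendZero, h, this]

/-- The bilinear form `(x, y) ↦ ∑ cᵢ xᵢ yᵢ₊₁`. -/
def shiftForm (n : ℕ) (c : ℕ → F) : LinearMap.BilinForm F (Fin n → F) :=
  LinearMap.mk₂ F (fun x y => ∑ i ∈ Finset.range n, c i * extendZero x i * extendZero y (i + 1))
    (fun x x' y => by simp [mul_add, add_mul, Finset.sum_add_distrib])
    (fun a x y => by simp only [map_smul, Pi.smul_apply, smul_eq_mul, Finset.mul_sum]
                     exact Finset.sum_congr rfl fun i _ => by ring)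
    (fun x y y' => by simp [mul_add, Finset.sum_add_distrib])
    (fun a x y => by simp only [map_smul, Pi.smul_apply, smul_eq_mul, Finset.mul_sum]
                     exact Finset.sum_congr rfl fun i _ => by ring)

theorem shiftForm_apply (c : ℕ → F) (x y : Fin n → F) :
    shiftForm n c x y =
      ∑ i ∈ Finset.range n, c i * extendZero x i * extendZero y (i + 1) := rfl

/-- The alternating form `(x, y) ↦ ∑ cᵢ (xᵢ yᵢ₊₁ - yᵢ xᵢ₊₁)`. -/
def commForm (n : ℕ) (c : ℕ → F) : LinearMap.BilinForm F (Fin n → F) :=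
  shiftForm n c - (shiftForm n c).flip

theorem commForm_apply (c : ℕ → F) (x y : Fin n → F) :
    commForm n c x y = shiftForm n c x y - shiftForm n c y x := rfl

theorem commForm_isRefl (c : ℕ → F) : (commForm n c).IsRefl := by
  intro x y h
  rw [commForm_apply] at h ⊢
  rw [← neg_sub, h, neg_zero]

/-- The radical of `commForm n c`. -/
def commRadical (n : ℕ) (c : ℕ → F) : Submodule F (Fin n → F) := (commForm n c).orthogonal ⊤

theorem mem_commRadical {c : ℕ → F} {x : Fin n → F} :
    x ∈ commRadical n c ↔ ∀ y, commForm n c y x = 0 := by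
  simp [commRadical, LinearMap.BilinForm.mem_orthogonal_iff]

/-- `z` marks every other index in each run of nonzero entries of `c`, starting from its last
one. -/
structure IsMarking (n : ℕ) (c : ℕ → F) (z : ℕ → Prop) : Prop where
  support : ∀ i, n ≤ i + 1 → c i = 0
  iff : ∀ i, z i ↔ c i ≠ 0 ∧ ¬ z (i + 1)

theorem IsMarking.lt {c : ℕ → F} {z : ℕ → Prop} (hz : IsMarking n c z) {i : ℕ} (h : z i) :
    i + 1 < n := by
  by_contra h'
  exact ((hz.iff i).1 h).1 (hz.support i (not_lt.1 h'))

theorem IsMarking.or {c : ℕ → F} {z : ℕ → Prop} (hz : IsMarking n c z) {i : ℕ} (h : c i ≠ 0) :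
    z i ∨ z (i + 1) := by
  by_cases h' : z (i + 1)
  · exact Or.inr h'
  · exact Or.inl ((hz.iff i).2 ⟨h, h'⟩)

/-- The vectors that vanish at the marked indices. -/
def unmarked (F : Type*) [Field F] (n : ℕ) (z : ℕ → Prop) : Submodule F (Fin n → F) where
  carrier := {x | ∀ i : Fin n, z i → x i = 0}
  zero_mem' := fun _ _ => rfl
  add_mem' := fun {a b} ha hb i hi => by simp [ha i hi, hb i hi]
  smul_mem' := fun a x hx i hi => by simp [hx i hi]

theorem mem_unmarked {z : ℕ → Prop} {x : Fin n → F} :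
    x ∈ unmarked F n z ↔ ∀ i : Fin n, z i → x i = 0 := Iff.rfl

theorem mem_unmarked_iff_extendZero {z : ℕ → Prop} {x : Fin n → F} :
    x ∈ unmarked F n z ↔ ∀ i : ℕ, z i → extendZero x i = 0 := by
  refine ⟨fun h i hi => ?_, fun h i hi => by rw [← extendZero_apply_fin x, h i hi]⟩
  by_cases hn : i < n
  · rw [← h ⟨i, hn⟩ hi, ← extendZero_apply_fin x]
  · exact extendZero_of_le _ (not_lt.1 hn)

theorem finrank_unmarked (z : ℕ → Prop) :
    finrank F (unmarked F n z) + Nat.card {i : Fin n // z i} = n := by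
  classical
  let f : (Fin n → F) →ₗ[F] ({i : Fin n // z i} → F) := LinearMap.funLeft F F Subtype.val
  have hk : LinearMap.ker f = unmarked F n z := by
    ext x
    simp [f, mem_unmarked, funext_iff, LinearMap.mem_ker, LinearMap.funLeft_apply]
  have hr : LinearMap.range f = ⊤ :=
    LinearMap.range_eq_top.2 (LinearMap.funLeft_surjective_of_injective F F
      (Subtype.val : {i : Fin n // z i} → Fin n) Subtype.val_injective)
  have := f.finrank_range_add_finrank_ker
  rw [hk, hr, finrank_top, finrank_fintype_fun_eq_card, finrank_fin_fun] at this
  rw [Nat.card_eq_fintype_card]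
  omega

theorem single_mem_unmarked {z : ℕ → Prop} {i : ℕ} (hi : i < n) (h : ¬ z i) :
    (Pi.single ⟨i, hi⟩ 1 : Fin n → F) ∈ unmarked F n z := by
  intro j hj
  rw [Pi.single_apply, if_neg]
  rintro rfl
  exact h hj

/-- Whenever `cᵢ ≠ 0`, one of `i`, `i + 1` is marked, so every term dies. The form itself vanishes,
not just its alternation; this is what makes `θ (levelTwo c g)` multiplicative later. -/
theorem shiftForm_eq_zero {c : ℕ → F} {z : ℕ → Prop} (hz : IsMarking n c z) {x y : Fin n → F}
    (hx : x ∈ unmarked F n z) (hy : y ∈ unmarked F n z) : shiftForm n c x y = 0 := by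
  rw [mem_unmarked_iff_extendZero] at hx hy
  rw [shiftForm_apply]
  refine Finset.sum_eq_zero fun i _ => ?_
  by_cases hc : c i = 0
  · simp [hc]
  · rcases hz.or hc with h | h
    · simp [hx i h]
    · simp [hy _ h]

theorem shiftForm_single_left (c : ℕ → F) (x : Fin n → F) {i : ℕ} (hi : i < n) :
    shiftForm n c (Pi.single ⟨i, hi⟩ 1) x = c i * extendZero x (i + 1) := by
  rw [shiftForm_apply, Finset.sum_eq_single i]
  · simp [extendZero_single]
  · intro j _ hj; simp [extendZero_single, hj]
  · simp [hi]

theorem shiftForm_single_right (c : ℕ → F) (x : Fin n → F) {i : ℕ} (hi : i + 1 < n) :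
    shiftForm n c x (Pi.single ⟨i + 1, hi⟩ 1) = c i * extendZero x i := by
  rw [shiftForm_apply, Finset.sum_eq_single i]
  · simp [extendZero_single]
  · intro j _ hj; simp [extendZero_single, hj]
  · intro h; simp at h; omega

theorem commForm_single (c : ℕ → F) (x : Fin n → F) {i : ℕ} (hi : i + 1 < n) :
    commForm n c (Pi.single ⟨i + 1, hi⟩ 1) x =
      c (i + 1) * extendZero x (i + 2) - c i * extendZero x i := by
  rw [commForm_apply, shiftForm_single_left, shiftForm_single_right]

/-- If `i` is marked then `i + 1` is not, and pairing with the basis vector at `i + 1` gives `cᵢ xᵢ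
= cᵢ₊₁ xᵢ₊₂`. Either `cᵢ₊₁ = 0` or `i + 2` is marked, so descending from the last index forces `xᵢ =
0`. -/
theorem orthogonal_unmarked {c : ℕ → F} {z : ℕ → Prop} (hz : IsMarking n c z) :
    (commForm n c).orthogonal (unmarked F n z) = unmarked F n z := by
  ext x
  rw [LinearMap.BilinForm.mem_orthogonal_iff]
  constructor
  · intro h
    rw [mem_unmarked_iff_extendZero]
    have key : ∀ m i, n ≤ i + m → z i → extendZero x i = 0 := by
      intro m
      induction m using Nat.strong_induction_on with
      | _ m ih =>
        intro i hm hi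
        have hin := hz.lt hi
        obtain ⟨hci, hni⟩ := (hz.iff i).1 hi
        have h0 := h _ (single_mem_unmarked hin hni)
        rw [commForm_single] at h0
        have h1 : c (i + 1) * extendZero x (i + 2) = 0 := by
          by_cases hc : c (i + 1) = 0
          · simp [hc]
          · have hz2 := (hz.or hc).resolve_left hni
            rw [ih (m - 2) (by omega) (i + 2) (by omega) hz2, mul_zero]
        rw [h1, zero_sub, neg_eq_zero] at h0
        exact (mul_eq_zero.1 h0).resolve_left hci
    exact fun i => key n i (by omega)
  · intro hx y hy
    rw [commForm_apply, shiftForm_eq_zero hz hx hy,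
      shiftForm_eq_zero hz hy hx, sub_zero]

theorem commRadical_le_unmarked {c : ℕ → F} {z : ℕ → Prop} (hz : IsMarking n c z) :
    commRadical n c ≤ unmarked F n z := by
  rw [← orthogonal_unmarked hz]
  exact LinearMap.BilinForm.orthogonal_le le_top

/-- With `W` the self-orthogonal subspace, `dim W + dim W^⊥ = n + dim (W ⊓ rad)`, and the radical is
contained in `W`; the codimension of `W` is the number of marks. -/
theorem finrank_commRadical {c : ℕ → F} {z : ℕ → Prop} (hz : IsMarking n c z) :
    finrank F (commRadical n c) + 2 * Nat.card {i : Fin n // z i} = n := by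
  have h1 := LinearMap.BilinForm.finrank_add_finrank_orthogonal (commForm_isRefl c)
    (unmarked F n z)
  have h2 := finrank_unmarked (F := F) (n := n) z
  change _ = _ + finrank F ↥(_ ⊓ commRadical n c) at h1
  rw [orthogonal_unmarked hz, inf_eq_right.2 (commRadical_le_unmarked hz), finrank_fin_fun] at h1
  omega

end AlternatingForm

/-! ### Entries of unitriangular matrices under multiplication -/

section Superdiagonals

variable {F : Type*} [Field F] {n : ℕ}

theorem eStar_apply_of_lt {N i j : ℕ} (hi : i < N) (hj : j < N) (X : nilU N F) :
    eStar i j X = (X : Matrix (Fin N) (Fin N) F) ⟨i, hi⟩ ⟨j, hj⟩ := by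
  simp [eStar, hi, hj]

theorem eStar_apply_of_le {N i j : ℕ} (hj : N ≤ j) (X : nilU N F) : eStar i j X = 0 := by
  simp [eStar, hj.not_gt]

theorem eStar_mul {N i j : ℕ} (hij : i ≤ j) (X Y : nilU N F) :
    eStar i j (X * Y) = ∑ k ∈ Finset.Ioo i j, eStar i k X * eStar k j Y := by
  by_cases hj : j < N
  · rw [eStar_apply_of_lt (hij.trans_lt hj) hj]
    change ((X : Matrix (Fin N) (Fin N) F) * (Y : Matrix (Fin N) (Fin N) F)) _ _ = _
    rw [Matrix.mul_apply]
    have hf : ∀ k : Fin N, (X : Matrix (Fin N) (Fin N) F) ⟨i, hij.trans_lt hj⟩ k *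
        (Y : Matrix (Fin N) (Fin N) F) k ⟨j, hj⟩ = eStar i k X * eStar k j Y := fun k => by
      rw [eStar_apply_of_lt (hij.trans_lt hj) k.2, eStar_apply_of_lt k.2 hj]
    rw [Finset.sum_congr rfl (fun k _ => hf k),
      Fin.sum_univ_eq_sum_range (fun k => eStar i k X * eStar k j Y) N]
    symm
    refine Finset.sum_subset (fun k hk => ?_) (fun k hk hk' => ?_)
    · rw [Finset.mem_Ioo] at hk; rw [Finset.mem_range]; omega
    · rw [Finset.mem_range] at hk
      rw [Finset.mem_Ioo, not_and_or, not_lt, not_lt] at hk'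
      rcases hk' with h | h
      · rw [eStar_apply_of_lt (hij.trans_lt hj) hk, X.2 _ _ (by simpa using h), zero_mul]
      · rw [eStar_apply_of_lt hk hj, Y.2 _ _ (by simpa using h), mul_zero]
  · rw [eStar_apply_of_le (not_lt.1 hj)]
    exact (Finset.sum_eq_zero fun k _ => by rw [eStar_apply_of_le (not_lt.1 hj), mul_zero]).symm

theorem eStar_mul_one {N : ℕ} (i : ℕ) (X Y : nilU N F) : eStar i (i + 1) (X * Y) = 0 := by
  rw [eStar_mul (by omega)]
  exact Finset.sum_eq_zero fun k hk => by rw [Finset.mem_Ioo] at hk; omega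

theorem eStar_mul_two {N : ℕ} (i : ℕ) (X Y : nilU N F) :
    eStar i (i + 2) (X * Y) = eStar i (i + 1) X * eStar (i + 1) (i + 2) Y := by
  rw [eStar_mul (by omega), show Finset.Ioo i (i + 2) = {i + 1} by
    ext k; rw [Finset.mem_Ioo, Finset.mem_singleton]; omega, Finset.sum_singleton]

theorem nilU_ext {N : ℕ} {X Y : nilU N F} (h : ∀ i j, i < j → eStar i j X = eStar i j Y) :
    X = Y := by
  apply Subtype.ext
  ext i j
  rcases le_or_gt j i with hij | hij
  · rw [X.2 i j hij, Y.2 i j hij]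
  · have := h i j hij
    rwa [eStar_apply_of_lt i.2 j.2, eStar_apply_of_lt i.2 j.2] at this

/-- The element of `𝔲_N(F)` with the given entries above the diagonal. -/
def nilOf (N : ℕ) (f : ℕ → ℕ → F) : nilU N F :=
  ⟨fun i j => if i < j then f i j else 0, fun _ _ h => if_neg h.not_gt⟩

theorem eStar_nilOf {N : ℕ} (f : ℕ → ℕ → F) {i j : ℕ} (hij : i < j) (hj : j < N) :
    eStar i j (nilOf N f) = f i j := by
  rw [eStar_apply_of_lt (hij.trans hj) hj]
  exact if_pos hij

theorem subOne_injective {N : ℕ} : Function.Injective (subOne : U N F → nilU N F) := by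
  intro g h hgh
  apply Subtype.ext
  apply Units.ext
  have := congrArg Subtype.val hgh
  simpa [subOne] using this

theorem subOne_surjective {N : ℕ} : Function.Surjective (subOne : U N F → nilU N F) := by
  intro X
  have ht : ((1 : Matrix (Fin N) (Fin N) F) + (X : Matrix (Fin N) (Fin N) F)).BlockTriangular id :=
    fun i j hij => by
      have hij' : j < i := hij
      simp [X.2 i j hij'.le, hij'.ne']
  have hdet : ((1 : Matrix (Fin N) (Fin N) F) + (X : Matrix (Fin N) (Fin N) F)).det = 1 := by
    rw [Matrix.det_of_isUpperTriangular ht]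
    exact Finset.prod_eq_one fun i _ => by simp [X.2 i i le_rfl]
  let g : GL (Fin N) F := Matrix.GeneralLinearGroup.mkOfDetNeZero _ (hdet ▸ one_ne_zero)
  refine ⟨⟨g, fun i j hij => ht hij, fun i => ?_⟩, ?_⟩
  · change ((1 : Matrix (Fin N) (Fin N) F) + (X : Matrix (Fin N) (Fin N) F)) i i = 1
    simp [X.2 i i le_rfl]
  · apply Subtype.ext
    change (1 : Matrix (Fin N) (Fin N) F) + (X : Matrix (Fin N) (Fin N) F) - 1 = _
    simp

/-- The bijection `g ↦ g - 1` as an equivalence. -/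
noncomputable def subOneEquiv (N : ℕ) (F : Type*) [Field F] : U N F ≃ nilU N F :=
  Equiv.ofBijective subOne ⟨subOne_injective, subOne_surjective⟩

/-- The element of `U_N(F)` with the given entries above the diagonal. -/
noncomputable def uniOf (N : ℕ) (f : ℕ → ℕ → F) : U N F := (subOneEquiv N F).symm (nilOf N f)

theorem subOne_uniOf {N : ℕ} (f : ℕ → ℕ → F) : subOne (uniOf N f) = nilOf N f :=
  (subOneEquiv N F).apply_symm_apply _

/-- The entry of `g` in row `i` and column `j` if `i < j` (and `0` out of range). -/
def entry {N : ℕ} (g : U N F) (i j : ℕ) : F := eStar i j (subOne g)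

theorem entry_uniOf {N : ℕ} (f : ℕ → ℕ → F) {i j : ℕ} (hij : i < j) (hj : j < N) :
    entry (uniOf N f) i j = f i j := by
  rw [entry, subOne_uniOf, eStar_nilOf f hij hj]

theorem entry_of_le {N : ℕ} (g : U N F) {i j : ℕ} (hj : N ≤ j) : entry g i j = 0 :=
  eStar_apply_of_le hj _

theorem entry_one {N : ℕ} (i j : ℕ) : entry (1 : U N F) i j = 0 := by
  rw [entry, subOne_one, map_zero]

theorem entry_mul {N : ℕ} (g h : U N F) {i j : ℕ} (hij : i ≤ j) :
    entry (g * h) i j =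
      entry g i j + entry h i j + ∑ k ∈ Finset.Ioo i j, entry g i k * entry h k j := by
  simp only [entry, subOne_mul, map_add, eStar_mul hij]

theorem entry_mul_one {N : ℕ} (g h : U N F) (i : ℕ) :
    entry (g * h) i (i + 1) = entry g i (i + 1) + entry h i (i + 1) := by
  simp only [entry, subOne_mul, map_add, eStar_mul_one, add_zero]

theorem entry_mul_two {N : ℕ} (g h : U N F) (i : ℕ) :
    entry (g * h) i (i + 2) =
      entry g i (i + 2) + entry h i (i + 2) + entry g i (i + 1) * entry h (i + 1) (i + 2) := by
  simp only [entry, subOne_mul, map_add, eStar_mul_two]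

theorem entry_ext {N : ℕ} {g h : U N F} (H : ∀ i j, i < j → entry g i j = entry h i j) :
    g = h := subOne_injective (nilU_ext H)

/-- The superdiagonal of an element of `U_{n+1}(F)`. -/
def superdiag (g : U (n + 1) F) : Fin n → F := fun i => entry g i (i + 1)

theorem extendZero_superdiag (g : U (n + 1) F) (i : ℕ) :
    extendZero (superdiag g) i = entry g i (i + 1) := by
  by_cases h : i < n
  · simp [extendZero, h, superdiag]
  · rw [extendZero_of_le _ (not_lt.1 h), entry_of_le _ (by omega)]

theorem superdiag_mul (g h : U (n + 1) F) : superdiag (g * h) = superdiag g + superdiag h := by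
  ext i
  exact entry_mul_one g h i

theorem superdiag_one : superdiag (1 : U (n + 1) F) = 0 := by
  ext i
  exact entry_one _ _

theorem superdiag_inv (g : U (n + 1) F) : superdiag g⁻¹ = -superdiag g := by
  rw [eq_neg_iff_add_eq_zero, ← superdiag_mul, inv_mul_cancel, superdiag_one]

end Superdiagonals

/-! ### The third term of the lower central series -/

section LowerSeries

variable {F : Type*} [Field F] {N : ℕ}

/-- The matrices in `U_N(F)` whose first `k` superdiagonals vanish. -/
def lowerSubgroup (N : ℕ) (F : Type*) [Field F] (k : ℕ) : Subgroup (U N F) where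
  carrier := {g | ∀ i j, i < j → j ≤ i + k → entry g i j = 0}
  one_mem' := fun i j _ _ => entry_one i j
  mul_mem' := by
    intro g h hg hh i j hij hj
    rw [entry_mul _ _ hij.le, hg i j hij hj, hh i j hij hj, Finset.sum_eq_zero]
    · simp
    · intro l hl
      rw [Finset.mem_Ioo] at hl
      rw [hg i l hl.1 (hl.2.le.trans hj), zero_mul]
  inv_mem' := by
    intro g hg i j hij hj
    have h := entry_mul g g⁻¹ hij.le
    rw [mul_inv_cancel, entry_one, hg i j hij hj, Finset.sum_eq_zero] at h
    · simpa using h.symm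
    · intro l hl
      rw [Finset.mem_Ioo] at hl
      rw [hg i l hl.1 (hl.2.le.trans hj), zero_mul]

theorem mem_lowerSubgroup_one {g : U N F} :
    g ∈ lowerSubgroup N F 1 ↔ ∀ i, entry g i (i + 1) = 0 :=
  ⟨fun h i => h i _ (by omega) le_rfl, fun h i j hij hj => by
    obtain rfl : j = i + 1 := by omega
    exact h i⟩

theorem mem_lowerSubgroup_two {g : U N F} :
    g ∈ lowerSubgroup N F 2 ↔ ∀ i, entry g i (i + 1) = 0 ∧ entry g i (i + 2) = 0 :=
  ⟨fun h i => ⟨h i _ (by omega) (by omega), h i _ (by omega) le_rfl⟩, fun h i j hij hj => by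
    obtain rfl | rfl : j = i + 1 ∨ j = i + 2 := by omega
    · exact (h i).1
    · exact (h i).2⟩

/-- On the first superdiagonal that may be nonzero, multiplication is addition: all cross terms
contain a vanishing entry of `g`. -/
theorem entry_mul_of_mem_lowerSubgroup {k : ℕ} {g : U N F} (hg : g ∈ lowerSubgroup N F k)
    (h : U N F) (i : ℕ) :
    entry (g * h) i (i + k + 1) = entry g i (i + k + 1) + entry h i (i + k + 1) := by
  rw [entry_mul _ _ (by omega), Finset.sum_eq_zero, add_zero]
  intro l hl
  rw [Finset.mem_Ioo] at hl
  rw [hg i l hl.1 (by omega), zero_mul]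

theorem commutator_mem_lowerSubgroup_one (g h : U N F) : ⁅g, h⁆ ∈ lowerSubgroup N F 1 := by
  rw [mem_lowerSubgroup_one]
  intro i
  have h1 : ⁅g, h⁆ * (h * g) = g * h := by rw [commutatorElement_def]; group
  have h2 := entry_mul_one ⁅g, h⁆ (h * g) i
  rw [h1, entry_mul_one, entry_mul_one] at h2
  linear_combination -h2

/-- Compare entries in `⁅g, h⁆ * (h * g) = g * h`; the commutator has zero superdiagonal, so its
second superdiagonal simply adds. -/
theorem entry_commutator_two (g h : U N F) (i : ℕ) :
    entry ⁅g, h⁆ i (i + 2) = entry g i (i + 1) * entry h (i + 1) (i + 2) -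
      entry h i (i + 1) * entry g (i + 1) (i + 2) := by
  have h1 : ⁅g, h⁆ * (h * g) = g * h := by rw [commutatorElement_def]; group
  have h2 := entry_mul_of_mem_lowerSubgroup (commutator_mem_lowerSubgroup_one g h) (h * g) i
  rw [h1] at h2
  change entry (g * h) i (i + 2) = entry _ i (i + 2) + entry (h * g) i (i + 2) at h2
  rw [entry_mul_two, entry_mul_two] at h2
  linear_combination -h2

/-- An elementary strictly upper triangular matrix. -/
def nilSingle {i j : Fin N} (h : i < j) (s : F) : nilU N F :=
  ⟨Matrix.single i j s, fun k l hkl => by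
    rw [Matrix.single_apply, if_neg]
    rintro ⟨rfl, rfl⟩
    exact absurd h hkl.not_gt⟩

theorem eStar_nilSingle {i j : Fin N} (h : i < j) (s : F) (k l : ℕ) :
    eStar k l (nilSingle h s) = if i = k ∧ j = l then s else 0 := by
  by_cases hkl : k < N ∧ l < N
  · rw [eStar_apply_of_lt hkl.1 hkl.2]
    simp [nilSingle, Matrix.single_apply, Fin.ext_iff]
  · have h1 : ¬ ((i : ℕ) = k ∧ (j : ℕ) = l) := fun h' => hkl (by
      rw [← h'.1, ← h'.2]; exact ⟨i.2, j.2⟩)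
    rw [if_neg h1]
    simp [eStar, hkl]

/-- An elementary unitriangular matrix. -/
noncomputable def uniSingle {i j : Fin N} (h : i < j) (s : F) : U N F :=
  (subOneEquiv N F).symm (nilSingle h s)

theorem subOne_uniSingle {i j : Fin N} (h : i < j) (s : F) :
    subOne (uniSingle h s) = nilSingle h s := (subOneEquiv N F).apply_symm_apply _

theorem nilSingle_mul_nilSingle_same {i j k : Fin N} (h : i < j) (h' : j < k) (s t : F) :
    nilSingle h s * nilSingle h' t = nilSingle (h.trans h') (s * t) :=
  Subtype.ext (Matrix.single_mul_single_same _ _ _ _ _)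

theorem nilSingle_mul_nilSingle_of_ne {i j k l : Fin N} (h : i < j) (h' : k < l) (hjk : j ≠ k)
    (s t : F) : nilSingle h s * nilSingle h' t = 0 :=
  Subtype.ext (Matrix.single_mul_single_of_ne _ _ _ _ hjk _)

theorem commutator_uniSingle {i j k : Fin N} (h : i < j) (h' : j < k) (s t : F) :
    ⁅uniSingle h s, uniSingle h' t⁆ = uniSingle (h.trans h') (s * t) := by
  rw [commutatorElement_def, mul_inv_eq_iff_eq_mul, mul_inv_eq_iff_eq_mul, mul_assoc]
  apply subOne_injective
  simp only [subOne_mul, subOne_uniSingle, mul_add]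
  rw [nilSingle_mul_nilSingle_same, nilSingle_mul_nilSingle_of_ne h' h (h.trans h').ne',
    nilSingle_mul_nilSingle_of_ne _ _ h'.ne', nilSingle_mul_nilSingle_of_ne _ _ (h.trans h').ne',
    mul_zero]
  abel

/-- A gap of three leaves room for `i < i + 1 < i + 2 < j`, which exhibits the matrix as a double
commutator of elementary ones. -/
theorem uniSingle_mem_commutator {i j : Fin N} (h : i < j) (hij : (i : ℕ) + 3 ≤ j) (s : F) :
    uniSingle h s ∈ ⁅(⊤ : Subgroup (U N F)), ⁅(⊤ : Subgroup (U N F)), (⊤ : Subgroup (U N F))⁆⁆ := by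
  have hj := j.2
  let a : Fin N := ⟨i + 1, by omega⟩
  let b : Fin N := ⟨i + 2, by omega⟩
  have h1 : i < a := Fin.lt_def.2 (by simp [a])
  have h2 : a < b := Fin.lt_def.2 (by simp [a, b])
  have h3 : b < j := Fin.lt_def.2 (by simp only [b]; omega)
  have hc := commutator_uniSingle h1 (h2.trans h3) (1 : F) s
  rw [one_mul] at hc
  have hd := commutator_uniSingle h2 h3 (1 : F) s
  rw [one_mul] at hd
  rw [← hc, ← hd]
  exact Subgroup.commutator_mem_commutator (Subgroup.mem_top _)
    (Subgroup.commutator_mem_commutator (Subgroup.mem_top _) (Subgroup.mem_top _))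

theorem commutator_le_lowerSubgroup_two :
    ⁅(⊤ : Subgroup (U N F)), ⁅(⊤ : Subgroup (U N F)), (⊤ : Subgroup (U N F))⁆⁆ ≤
      lowerSubgroup N F 2 := by
  have h1 : ⁅(⊤ : Subgroup (U N F)), (⊤ : Subgroup (U N F))⁆ ≤ lowerSubgroup N F 1 :=
    Subgroup.commutator_le.2 fun g _ h _ => commutator_mem_lowerSubgroup_one g h
  refine Subgroup.commutator_le.2 fun g _ h hh => ?_
  have hh1 := mem_lowerSubgroup_one.1 (h1 hh)
  rw [mem_lowerSubgroup_two]
  intro i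
  refine ⟨mem_lowerSubgroup_one.1 (commutator_mem_lowerSubgroup_one g h) i, ?_⟩
  rw [entry_commutator_two, hh1 i, show entry h (i + 1) (i + 2) = 0 from hh1 (i + 1)]
  ring

/-- Any prescribed superdiagonal beyond the second is realised inside the commutator subgroup, one
elementary factor per entry. -/
theorem exists_mem_commutator_entry {k : ℕ} (hk : 2 ≤ k) (a : ℕ → F) (s : Finset ℕ) :
    ∃ h ∈ ⁅(⊤ : Subgroup (U N F)), ⁅(⊤ : Subgroup (U N F)), (⊤ : Subgroup (U N F))⁆⁆,
      h ∈ lowerSubgroup N F k ∧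
        ∀ i, i + k + 1 < N → entry h i (i + k + 1) = if i ∈ s then a i else 0 := by
  classical
  induction s using Finset.induction_on with
  | empty => exact ⟨1, one_mem _, one_mem _, fun i _ => by simp [entry_one]⟩
  | insert l s hl ih =>
    obtain ⟨h, h1, h2, h3⟩ := ih
    by_cases hlN : l + k + 1 < N
    · let p : Fin N := ⟨l, by omega⟩
      let q : Fin N := ⟨l + k + 1, hlN⟩
      have hpq : p < q := Fin.lt_def.2 (by simp only [p, q]; omega)
      have he : ∀ i j, entry (uniSingle hpq (a l)) i j = if l = i ∧ l + k + 1 = j then a l else 0 :=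
        fun i j => by rw [entry, subOne_uniSingle, eStar_nilSingle]
      have hm : uniSingle hpq (a l) ∈ lowerSubgroup N F k := by
        intro i j hij hj
        rw [he, if_neg]
        omega
      refine ⟨uniSingle hpq (a l) * h, mul_mem (uniSingle_mem_commutator hpq
        (by simp only [p, q]; omega) _) h1, mul_mem hm h2, fun i hi => ?_⟩
      rw [entry_mul_of_mem_lowerSubgroup hm, he, h3 i hi]
      by_cases hil : i = l
      · subst hil; simp [hl]
      · have : ¬ (l = i ∧ l + k + 1 = i + k + 1) := fun h => hil h.1.symm
        rw [if_neg this, zero_add]; simp [hil]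
    · refine ⟨h, h1, h2, fun i hi => ?_⟩
      have : i ≠ l := by rintro rfl; exact hlN hi
      rw [h3 i hi]
      simp [this]

/-- Divide off one superdiagonal at a time. The number `m` bounds how many remain; once `N ≤ k` only
the identity is left. -/
theorem lowerSubgroup_le_commutator (m k : ℕ) (hk : 2 ≤ k) (hm : N ≤ k + m) :
    lowerSubgroup N F k ≤
      ⁅(⊤ : Subgroup (U N F)), ⁅(⊤ : Subgroup (U N F)), (⊤ : Subgroup (U N F))⁆⁆ := by
  induction m generalizing k with
  | zero =>
    intro g hg
    have : g = 1 := entry_ext fun i j hij => by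
      rw [entry_one]
      by_cases hj : j < N
      · exact hg i j hij (by omega)
      · exact entry_of_le g (not_lt.1 hj)
    rw [this]
    exact one_mem _
  | succ m ih =>
    intro g hg
    obtain ⟨h, h1, h2, h3⟩ :=
      exists_mem_commutator_entry (N := N) hk (fun i => entry g i (i + k + 1)) (Finset.range N)
    have hmem : h⁻¹ * g ∈ lowerSubgroup N F (k + 1) := by
      intro i j hij hj
      by_cases hjk : j ≤ i + k
      · exact mul_mem (inv_mem h2) hg i j hij hjk
      · obtain rfl : j = i + k + 1 := by omega
        by_cases hN : i + k + 1 < N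
        · have := entry_mul_of_mem_lowerSubgroup h2 (h⁻¹ * g) i
          rw [mul_inv_cancel_left, h3 i hN, if_pos (Finset.mem_range.2 (by omega))] at this
          linear_combination -this
        · exact entry_of_le _ (not_lt.1 hN)
    have := mul_mem h1 (ih (k + 1) (by omega) (by omega) hmem)
    rwa [mul_inv_cancel_left] at this

/-- The third term of the lower central series of `U_N(F)`. -/
theorem commutator_eq_lowerSubgroup_two :
    ⁅(⊤ : Subgroup (U N F)), ⁅(⊤ : Subgroup (U N F)), (⊤ : Subgroup (U N F))⁆⁆ =
      lowerSubgroup N F 2 :=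
  le_antisymm commutator_le_lowerSubgroup_two (lowerSubgroup_le_commutator N 2 le_rfl (by omega))

end LowerSeries

/-! ### Heisenberg characters built from a vector and a character of its radical -/

section HeisenbergCharacters

variable {F : Type*} [Field F] {n : ℕ}

/-- The number of marked indices below `n`. -/
noncomputable def markCount (n : ℕ) (z : ℕ → Prop) : ℕ := Nat.card {i : Fin n // z i}

/-- The superdiagonal as a homomorphism. -/
def superdiagHom (n : ℕ) (F : Type*) [Field F] : U (n + 1) F →* Multiplicative (Fin n → F) where
  toFun g := Multiplicative.ofAdd (superdiag g)
  map_one' := congrArg _ superdiag_one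
  map_mul' g h := congrArg _ (superdiag_mul g h)

/-- The elements whose superdiagonal lies in `S`. -/
def superdiagComap (S : Submodule F (Fin n → F)) : Subgroup (U (n + 1) F) :=
  (AddSubgroup.toSubgroup S.toAddSubgroup).comap (superdiagHom n F)

theorem mem_superdiagComap {S : Submodule F (Fin n → F)} {g : U (n + 1) F} :
    g ∈ superdiagComap S ↔ superdiag g ∈ S := Iff.rfl

/-- The unitriangular matrix with the given superdiagonal and zeros above it. -/
noncomputable def ofSuperdiag (r : Fin n → F) : U (n + 1) F :=
  uniOf (n + 1) fun i j => if j = i + 1 then extendZero r i else 0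

theorem superdiag_ofSuperdiag (r : Fin n → F) : superdiag (ofSuperdiag r) = r := by
  ext i
  rw [superdiag, ofSuperdiag, entry_uniOf _ (by omega) (by omega), if_pos rfl, extendZero_apply_fin]

theorem entry_ofSuperdiag_two (r : Fin n → F) (i : ℕ) : entry (ofSuperdiag r) i (i + 2) = 0 := by
  by_cases h : i + 2 < n + 1
  · rw [ofSuperdiag, entry_uniOf _ (by omega) h, if_neg (by omega)]
  · exact entry_of_le _ (not_lt.1 h)

theorem superdiagHom_surjective : Function.Surjective (superdiagHom n F) :=
  fun r => ⟨ofSuperdiag r.toAdd, congrArg Multiplicative.ofAdd (superdiag_ofSuperdiag _)⟩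

theorem index_superdiagComap [Finite F] (S : Submodule F (Fin n → F)) {e : ℕ}
    (he : finrank F S + e = n) : (superdiagComap S).index = Nat.card F ^ e := by
  have h1 : (superdiagComap S).index = S.toAddSubgroup.index := by
    rw [superdiagComap, Subgroup.index_comap_of_surjective _ superdiagHom_surjective]
    rfl
  have h2 := S.toAddSubgroup.card_mul_index
  have h3 : Nat.card S.toAddSubgroup = Nat.card F ^ finrank F S :=
    Module.natCard_eq_pow_finrank (K := F) (V := S)
  have h4 : Nat.card (Fin n → F) = Nat.card F ^ n := by simp [Nat.card_fun]
  rw [← h1, h3, h4] at h2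
  have h5 : Nat.card F ^ n = Nat.card F ^ finrank F S * Nat.card F ^ e := by rw [← pow_add, he]
  rw [h5] at h2
  exact Nat.eq_of_mul_eq_mul_left (pow_pos Nat.card_pos _) h2

/-- The functional `g ↦ ∑ cᵢ gᵢ,ᵢ₊₂` of the second superdiagonal. -/
def levelTwo (c : ℕ → F) (g : U (n + 1) F) : F :=
  ∑ i ∈ Finset.range n, c i * entry g i (i + 2)

/-- `shiftForm` measures the failure of the second-level functional to be additive. -/
theorem levelTwo_mul (c : ℕ → F) (g h : U (n + 1) F) :
    levelTwo c (g * h) =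
      levelTwo c g + levelTwo c h + shiftForm n c (superdiag g) (superdiag h) := by
  rw [levelTwo, levelTwo, levelTwo, shiftForm_apply, ← Finset.sum_add_distrib,
    ← Finset.sum_add_distrib]
  refine Finset.sum_congr rfl fun i _ => ?_
  rw [extendZero_superdiag, extendZero_superdiag, entry_mul_two]
  ring

theorem levelTwo_one (c : ℕ → F) : levelTwo c (1 : U (n + 1) F) = 0 := by
  simp [levelTwo, entry_one]

theorem levelTwo_ofSuperdiag (c : ℕ → F) (r : Fin n → F) : levelTwo c (ofSuperdiag r) = 0 := by
  simp [levelTwo, entry_ofSuperdiag_two]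

theorem superdiag_commutator (g h : U (n + 1) F) : superdiag ⁅g, h⁆ = 0 := by
  ext i
  exact mem_lowerSubgroup_one.1 (commutator_mem_lowerSubgroup_one g h) i

theorem levelTwo_commutator (c : ℕ → F) (g h : U (n + 1) F) :
    levelTwo c ⁅g, h⁆ = commForm n c (superdiag g) (superdiag h) := by
  rw [levelTwo, commForm_apply, shiftForm_apply, shiftForm_apply, ← Finset.sum_sub_distrib]
  refine Finset.sum_congr rfl fun i _ => ?_
  rw [extendZero_superdiag, extendZero_superdiag, extendZero_superdiag, extendZero_superdiag,
    entry_commutator_two]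
  ring

open Classical in
/-- The linear character `g ↦ θ (∑ cᵢ gᵢ,ᵢ₊₂) η (g)` of the elements whose superdiagonal is in the
radical of `commForm n c`, extended by zero. -/
noncomputable def radicalChar (θ : AddChar F ℂ) (c : ℕ → F) (η : AddChar (commRadical n c) ℂ)
    (g : U (n + 1) F) : ℂ :=
  if h : superdiag g ∈ commRadical n c then θ (levelTwo c g) * η ⟨superdiag g, h⟩ else 0

section RadicalChar

variable {θ : AddChar F ℂ} {c : ℕ → F} {η : AddChar (commRadical n c) ℂ}

theorem radicalChar_of_mem {g : U (n + 1) F} (h : superdiag g ∈ commRadical n c) :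
    radicalChar θ c η g = θ (levelTwo c g) * η ⟨superdiag g, h⟩ := dif_pos h

theorem radicalChar_of_notMem {g : U (n + 1) F} (h : superdiag g ∉ commRadical n c) :
    radicalChar θ c η g = 0 := dif_neg h

theorem radicalChar_of_superdiag_eq_zero {g : U (n + 1) F} (h : superdiag g = 0) :
    radicalChar θ c η g = θ (levelTwo c g) := by
  have h' : superdiag g ∈ commRadical n c := h ▸ zero_mem _
  rw [radicalChar_of_mem h']
  have : (⟨superdiag g, h'⟩ : commRadical n c) = 0 := Subtype.ext h
  rw [this, AddChar.map_zero_eq_one, mul_one]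

theorem radicalChar_one : radicalChar θ c η (1 : U (n + 1) F) = 1 := by
  rw [radicalChar_of_superdiag_eq_zero superdiag_one, levelTwo_one, AddChar.map_zero_eq_one]

/-- The radical lies in the unmarked subspace, on which the correction term of `levelTwo_mul`
vanishes. -/
theorem radicalChar_mul {z : ℕ → Prop} (hz : IsMarking n c z) {g h : U (n + 1) F}
    (hg : superdiag g ∈ commRadical n c) (hh : superdiag h ∈ commRadical n c) :
    radicalChar θ c η (g * h) = radicalChar θ c η g * radicalChar θ c η h := by
  have hgh : superdiag (g * h) ∈ commRadical n c := by
    rw [superdiag_mul]; exact add_mem hg hh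
  rw [radicalChar_of_mem hg, radicalChar_of_mem hh, radicalChar_of_mem hgh, levelTwo_mul,
    shiftForm_eq_zero hz (commRadical_le_unmarked hz hg) (commRadical_le_unmarked hz hh), add_zero,
    AddChar.map_add_eq_mul]
  have : (⟨superdiag (g * h), hgh⟩ : commRadical n c) = ⟨superdiag g, hg⟩ + ⟨superdiag h, hh⟩ :=
    Subtype.ext (superdiag_mul g h)
  rw [this, AddChar.map_add_eq_mul]
  ring

theorem superdiag_conj (g h : U (n + 1) F) : superdiag (h * g * h⁻¹) = superdiag g := by
  rw [superdiag_mul, superdiag_mul, superdiag_inv]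
  abel

theorem conj_eq_commutator_mul {G : Type*} [Group G] (g h : G) : h * g * h⁻¹ = ⁅h, g⁆ * g := by
  rw [commutatorElement_def]; group

theorem radicalChar_conj {z : ℕ → Prop} (hz : IsMarking n c z) {g : U (n + 1) F}
    (hg : superdiag g ∈ commRadical n c) (h : U (n + 1) F) :
    radicalChar θ c η (h * g * h⁻¹) = radicalChar θ c η g := by
  rw [conj_eq_commutator_mul, radicalChar_mul hz (by rw [superdiag_commutator]; exact zero_mem _) hg,
    radicalChar_of_superdiag_eq_zero (superdiag_commutator _ _), levelTwo_commutator,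
    mem_commRadical.1 hg, AddChar.map_zero_eq_one, one_mul]

/-- Some `y` pairs nontrivially with the superdiagonal of `g`; rescaling it makes the pairing equal
to a `t` with `θ t ≠ 1`. -/
theorem exists_radicalChar_commutator_ne_one (hθ : θ ≠ 1) {g : U (n + 1) F}
    (hg : superdiag g ∉ commRadical n c) :
    ∃ h, ∃ w ∈ superdiagComap (commRadical n c),
      h * g * h⁻¹ = w * g ∧ radicalChar θ c η w ≠ 1 := by
  rw [mem_commRadical] at hg
  push Not at hg
  obtain ⟨y, hy⟩ := hg
  obtain ⟨t, ht⟩ := AddChar.ne_one_iff.1 hθ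
  refine ⟨ofSuperdiag ((t / commForm n c y (superdiag g)) • y), _, ?_,
    conj_eq_commutator_mul _ _, ?_⟩
  · rw [mem_superdiagComap, superdiag_commutator]; exact zero_mem _
  · rw [radicalChar_of_superdiag_eq_zero (superdiag_commutator _ _), levelTwo_commutator,
      superdiag_ofSuperdiag, map_smul, LinearMap.smul_apply, smul_eq_mul, div_mul_cancel₀ _ hy]
    exact ht

/-- An irreducible representation in which the radical acts by the linear character
`radicalChar θ c η`. -/
theorem character_eq_radicalChar [Finite F] (hθ : θ ≠ 1) {z : ℕ → Prop} (hz : IsMarking n c z)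
    {V : Type*} [AddCommGroup V] [Module ℂ V] [FiniteDimensional ℂ V]
    (ρ : Representation ℂ (U (n + 1) F) V) (hρ : ρ.IsIrreducible)
    (h : ∀ g ∈ superdiagComap (commRadical n c), ρ g = radicalChar θ c η g • 1) :
    ρ.character = fun g => (Nat.card F : ℂ) ^ markCount n z * radicalChar θ c η g := by
  obtain ⟨h1, h2⟩ := character_of_scalar ρ hρ (superdiagComap (commRadical n c))
    (radicalChar θ c η) h
    (fun g hg => exists_radicalChar_commutator_ne_one hθ (fun hg' => hg hg'))
  -- The radical has codimension twice the number of marks, so the squared dimension equals `q ^ (2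
  -- * markCount n z)`.
  have h3 := index_superdiagComap (commRadical n c) (finrank_commRadical hz)
  rw [← (superdiagComap (commRadical n c)).index_mul_card, h3, mul_comm 2, pow_mul] at h2
  have h4 : finrank ℂ V = Nat.card F ^ markCount n z :=
    Nat.pow_left_injective (n := 2) (by norm_num) (Nat.eq_of_mul_eq_mul_right Nat.card_pos h2)
  funext g
  rw [h1 g, h4]
  split_ifs with hg
  · push_cast; rfl
  · rw [radicalChar_of_notMem hg, mul_zero]

theorem isHeisenberg_radicalChar [Finite F] (hθ : θ ≠ 1) {z : ℕ → Prop} (hz : IsMarking n c z) :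
    IsHeisenberg fun g => (Nat.card F : ℂ) ^ markCount n z * radicalChar θ c η g := by
  constructor
  · obtain ⟨d, σ, h1, h2⟩ := exists_irreducible_of_linear (superdiagComap (commRadical n c))
      (radicalChar θ c η) radicalChar_one (fun g hg h hh => radicalChar_mul hz hg hh)
      (fun h g hg => ⟨by rw [mem_superdiagComap, superdiag_conj]; exact hg,
        radicalChar_conj hz hg h⟩)
    exact ⟨_, _, _, inferInstance, σ, h1, character_eq_radicalChar hθ hz σ h1 h2⟩
  · intro g hg
    rw [commutator_eq_lowerSubgroup_two] at hg
    have hg' := mem_lowerSubgroup_two.1 hg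
    have h0 : superdiag g = 0 := by ext i; exact (hg' i).1
    have h1 : levelTwo c g = 0 := Finset.sum_eq_zero fun i _ => by rw [(hg' i).2, mul_zero]
    beta_reduce
    rw [radicalChar_one, radicalChar_of_superdiag_eq_zero h0, h1, AddChar.map_zero_eq_one]

end RadicalChar

end HeisenbergCharacters

/-! ### Every Heisenberg character arises exactly once -/

section Classification

variable {F : Type*} [Field F] {n : ℕ}

/-- Every additive character of a finite field is a multiplicative shift of a nontrivial one. -/
theorem exists_eq_mulShift [Finite F] {θ : AddChar F ℂ} (hθ : θ ≠ 1) (ψ : AddChar F ℂ) :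
    ∃ a, ∀ x, ψ x = θ (a * x) := by
  classical
  have := Fintype.ofFinite F
  have hinj := AddChar.to_mulShift_inj_of_isPrimitive (AddChar.IsPrimitive.of_ne_one hθ)
  -- The map from `F` to its character group is injective, and the two have the same size.
  obtain ⟨a, ha⟩ := ((Fintype.bijective_iff_injective_and_card _).2
    ⟨hinj, (AddChar.card_eq (α := F)).symm⟩).2 ψ
  exact ⟨a, fun x => by rw [← ha]; rfl⟩

theorem addChar_sum_eq_prod {ι A : Type*} [AddCommMonoid A] (ψ : AddChar A ℂ) (s : Finset ι)
    (f : ι → A) : ψ (∑ i ∈ s, f i) = ∏ i ∈ s, ψ (f i) := by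
  classical
  induction s using Finset.induction_on with
  | empty => simp
  | insert i s hi ih => rw [Finset.sum_insert hi, Finset.prod_insert hi, AddChar.map_add_eq_mul, ih]

theorem exists_eq_sum_mul [Finite F] {θ : AddChar F ℂ} (hθ : θ ≠ 1) {m : ℕ}
    (Ψ : AddChar (Fin m → F) ℂ) : ∃ c : Fin m → F, ∀ y, Ψ y = θ (∑ i, c i * y i) := by
  have h : ∀ i, ∃ a, ∀ x, Ψ (Pi.single i x) = θ (a * x) := fun i =>
    exists_eq_mulShift hθ
      (Ψ.compAddMonoidHom (AddMonoidHom.single (fun _ : Fin m => F) i))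
  choose c hc using h
  refine ⟨c, fun y => ?_⟩
  conv_lhs => rw [← Finset.univ_sum_single y]
  rw [addChar_sum_eq_prod, addChar_sum_eq_prod]
  exact Finset.prod_congr rfl fun i _ => hc i _

/-- The unitriangular matrix with the given second superdiagonal and zeros elsewhere. -/
noncomputable def ofSecond {m : ℕ} (n : ℕ) (y : Fin m → F) : U (n + 1) F :=
  uniOf (n + 1) fun i j => if j = i + 2 then extendZero y i else 0

theorem entry_ofSecond_one {m : ℕ} (y : Fin m → F) (i : ℕ) :
    entry (ofSecond n y) i (i + 1) = 0 := by
  by_cases h : i + 1 < n + 1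
  · rw [ofSecond, entry_uniOf _ (by omega) h, if_neg (by omega)]
  · exact entry_of_le _ (not_lt.1 h)

theorem superdiag_ofSecond {m : ℕ} (y : Fin m → F) : superdiag (ofSecond n y) = 0 := by
  ext i
  exact entry_ofSecond_one y i

theorem entry_ofSecond_two {m : ℕ} (y : Fin m → F) (i : ℕ) :
    entry (ofSecond (m + 1) y) i (i + 2) = extendZero y i := by
  by_cases h : i + 2 < m + 1 + 1
  · rw [ofSecond, entry_uniOf _ (by omega) h, if_pos rfl]
  · rw [entry_of_le _ (not_lt.1 h), extendZero_of_le _ (by omega)]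

theorem levelTwo_extendZero {m : ℕ} (c : Fin m → F) (g : U (m + 1 + 1) F) :
    levelTwo (extendZero c) g = ∑ i, c i * entry g i (i + 2) := by
  rw [levelTwo, Finset.sum_range_succ, extendZero_of_le c le_rfl, zero_mul, add_zero,
    ← Fin.sum_univ_eq_sum_range (fun i => extendZero c i * entry g i (i + 2)) m]
  simp only [extendZero_apply_fin]

theorem levelTwo_ofSecond {m : ℕ} (c y : Fin m → F) :
    levelTwo (extendZero c) (ofSecond (m + 1) y) = ∑ i, c i * y i := by
  rw [levelTwo_extendZero]
  simp only [entry_ofSecond_two, extendZero_apply_fin]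

/-- A representation that is trivial on the matrices whose first two superdiagonals vanish depends
only on the first two superdiagonals. -/
theorem apply_eq_of_entry_eq {V : Type*} [AddCommGroup V] [Module ℂ V]
    {ρ : Representation ℂ (U (n + 1) F) V} (h1 : ∀ g ∈ lowerSubgroup (n + 1) F 2, ρ g = 1)
    {g h : U (n + 1) F} (hgh : ∀ i, entry g i (i + 1) = entry h i (i + 1))
    (hgh' : ∀ i, entry g i (i + 2) = entry h i (i + 2)) : ρ g = ρ h := by
  have h0 : ∀ i, entry (h⁻¹ * g) i (i + 1) = 0 := fun i => by
    have := entry_mul_one h (h⁻¹ * g) i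
    rw [mul_inv_cancel_left, hgh] at this
    linear_combination -this
  have hmem : h⁻¹ * g ∈ lowerSubgroup (n + 1) F 2 := by
    rw [mem_lowerSubgroup_two]
    refine fun i => ⟨h0 i, ?_⟩
    have := entry_mul_two h (h⁻¹ * g) i
    rw [mul_inv_cancel_left, hgh', show entry (h⁻¹ * g) (i + 1) (i + 2) = 0 from h0 (i + 1)] at this
    linear_combination -this
  rw [← mul_inv_cancel_left h g, map_mul, h1 _ hmem, mul_one]

/-- Every Heisenberg character comes from a linear character of a radical. -/
theorem exists_eq_radicalChar [Finite F] {θ : AddChar F ℂ} (hθ : θ ≠ 1) {m : ℕ}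
    (hz : ∀ c : Fin m → F, ∃ z, IsMarking (m + 1) (extendZero c) z) {χ : U (m + 1 + 1) F → ℂ}
    (hχ : IsHeisenberg χ) :
    ∃ (c : Fin m → F) (η : AddChar (commRadical (m + 1) (extendZero c)) ℂ),
      ∀ z, IsMarking (m + 1) (extendZero c) z →
        χ = fun g => (Nat.card F : ℂ) ^ markCount (m + 1) z * radicalChar θ (extendZero c) η g := by
  obtain ⟨⟨V, _, _, _, ρ, hρ, rfl⟩, hker⟩ := hχ
  have := nontrivial_of_isIrreducible ρ hρ
  have hscal : ∀ {a b : ℂ}, a • (1 : V →ₗ[ℂ] V) = b • (1 : V →ₗ[ℂ] V) → a = b := fun h =>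
    smul_left_injective ℂ one_ne_zero h
  rw [commutator_eq_lowerSubgroup_two] at hker
  have h2 : ∀ g ∈ lowerSubgroup (m + 1 + 1) F 2, ρ g = 1 := apply_eq_one_of_character ρ _ hker
  have hcomm : ∀ {g h : U (m + 1 + 1) F}, ρ ⁅g, h⁆ = 1 → Commute (ρ h) (ρ g) := by
    intro g h hgh
    have : g * h = ⁅g, h⁆ * (h * g) := by rw [commutatorElement_def]; group
    have := congrArg ρ this
    rw [map_mul, map_mul, hgh, one_mul, map_mul] at this
    exact this.symm
  -- Commutators with these matrices lie in the third term of the series, so Schur's lemma applies.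
  have hS : ∀ y : Fin m → F, ∃ a : ℂ, ρ (ofSecond (m + 1) y) = a • 1 := fun y =>
    exists_scalar_of_commute ρ hρ _ fun g => hcomm <| by
      refine h2 _ (mem_lowerSubgroup_two.2 fun i => ⟨mem_lowerSubgroup_one.1
        (commutator_mem_lowerSubgroup_one _ _) i, ?_⟩)
      rw [entry_commutator_two, entry_ofSecond_one y i,
        show entry (ofSecond (m + 1) y) (i + 1) (i + 2) = 0 from entry_ofSecond_one y (i + 1)]
      ring
  choose a ha using hS
  have ha0 : a 0 = 1 := hscal <| by
    rw [← ha, one_smul]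
    refine h2 _ (mem_lowerSubgroup_two.2 fun i => ⟨entry_ofSecond_one _ _, ?_⟩)
    rw [entry_ofSecond_two]; simp
  have hadd : ∀ y y', a (y + y') = a y * a y' := fun y y' => hscal <| by
    rw [← ha, apply_eq_of_entry_eq (h := ofSecond (m + 1) y * ofSecond (m + 1) y') h2, map_mul, ha,
      ha, smul_mul_smul_comm, one_mul]
    · intro i
      rw [entry_mul_one]; simp only [entry_ofSecond_one, add_zero]
    · intro i
      rw [entry_mul_two]; simp only [entry_ofSecond_one, entry_ofSecond_two]; simp
  let Ψ : AddChar (Fin m → F) ℂ := ⟨a, ha0, hadd⟩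
  obtain ⟨c, hc⟩ := exists_eq_sum_mul hθ Ψ
  have hlow : ∀ g : U (m + 1 + 1) F, superdiag g = 0 → ρ g = θ (levelTwo (extendZero c) g) • 1 := by
    intro g hg
    have hg' : ∀ i, entry g i (i + 1) = 0 := fun i => by
      rw [← extendZero_superdiag, hg]; simp
    rw [apply_eq_of_entry_eq (h := ofSecond (m + 1) fun i : Fin m => entry g i (i + 2)) h2, ha]
    · congr 1
      rw [levelTwo_extendZero]
      exact hc _
    · intro i; rw [hg', entry_ofSecond_one]
    · intro i
      rw [entry_ofSecond_two]
      by_cases hi : i < m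
      · simp [extendZero, hi]
      · rw [extendZero_of_le _ (not_lt.1 hi), entry_of_le _ (by omega)]
  obtain ⟨z, hz⟩ := hz c
  -- Commutators with these matrices act by `θ` of a pairing with the radical, hence trivially.
  have hR : ∀ r : commRadical (m + 1) (extendZero c), ∃ b : ℂ, ρ (ofSuperdiag r.1) = b • 1 :=
    fun r => exists_scalar_of_commute ρ hρ _ fun g => hcomm <| by
      rw [hlow _ (superdiag_commutator _ _), levelTwo_commutator, superdiag_ofSuperdiag,
        mem_commRadical.1 r.2, AddChar.map_zero_eq_one, one_smul]
  choose b hb using hR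
  have hrad : ∀ (g : U (m + 1 + 1) F) (hg : superdiag g ∈ commRadical (m + 1) (extendZero c)),
      ρ g = (θ (levelTwo (extendZero c) g) * b ⟨superdiag g, hg⟩) • 1 := by
    intro g hg
    -- Factor `g` into a part with zero superdiagonal, which carries all of `levelTwo`, and the
    -- standard lift of its superdiagonal.
    have h0 : superdiag (g * (ofSuperdiag (superdiag g))⁻¹) = 0 := by
      rw [superdiag_mul, superdiag_inv, superdiag_ofSuperdiag, add_neg_cancel]
    have h1 := levelTwo_mul (extendZero c) (g * (ofSuperdiag (superdiag g))⁻¹)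
      (ofSuperdiag (superdiag g))
    rw [inv_mul_cancel_right, h0, levelTwo_ofSuperdiag, map_zero, LinearMap.zero_apply, add_zero,
      add_zero] at h1
    conv_lhs => rw [← inv_mul_cancel_right g (ofSuperdiag (superdiag g))]
    rw [map_mul, hlow _ h0, ← h1, hb ⟨superdiag g, hg⟩, smul_mul_smul_comm, one_mul]
  have hb0 : b 0 = 1 := hscal <| by
    rw [← hb 0, ZeroMemClass.coe_zero, hlow _ (superdiag_ofSuperdiag _), levelTwo_ofSuperdiag, AddChar.map_zero_eq_one]
  have hbadd : ∀ r r', b (r + r') = b r * b r' := fun r r' => hscal <| by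
    have hs : superdiag (ofSuperdiag r.1 * ofSuperdiag r'.1) = (r + r').1 := by
      rw [superdiag_mul, superdiag_ofSuperdiag, superdiag_ofSuperdiag]; rfl
    have h1 := hrad (ofSuperdiag r.1 * ofSuperdiag r'.1) (hs ▸ (r + r').2)
    rw [levelTwo_mul, levelTwo_ofSuperdiag, levelTwo_ofSuperdiag, superdiag_ofSuperdiag,
      superdiag_ofSuperdiag, shiftForm_eq_zero hz (commRadical_le_unmarked hz r.2)
        (commRadical_le_unmarked hz r'.2), add_zero, add_zero, AddChar.map_zero_eq_one,
      one_mul, map_mul, hb, hb, smul_mul_smul_comm, one_mul] at h1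
    rw [h1]
    congr 2
    exact Subtype.ext hs.symm
  refine ⟨c, ⟨b, hb0, hbadd⟩, fun z hz => character_eq_radicalChar hθ hz ρ hρ fun g hg => ?_⟩
  rw [radicalChar_of_mem hg]
  exact hrad g hg

/-- The linear characters of the radicals give different Heisenberg characters. -/
theorem radicalChar_injective [Finite F] {θ : AddChar F ℂ} (hθ : θ ≠ 1) {m : ℕ} {e e' : ℕ}
    {p p' : Σ c : Fin m → F, AddChar (commRadical (m + 1) (extendZero c)) ℂ}
    (h : (fun g : U (m + 1 + 1) F =>
        (Nat.card F : ℂ) ^ e * radicalChar θ (extendZero p.1) p.2 g) =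
      fun g => (Nat.card F : ℂ) ^ e' * radicalChar θ (extendZero p'.1) p'.2 g) : p = p' := by
  obtain ⟨c, η⟩ := p
  obtain ⟨c', η'⟩ := p'
  have h1 := congrFun h 1
  simp only [radicalChar_one, mul_one] at h1
  have hne : (Nat.card F : ℂ) ^ e' ≠ 0 := pow_ne_zero _ (by exact_mod_cast Nat.card_pos.ne')
  -- The values at `1` identify the two powers of `q`. Matrices supported on the second
  -- superdiagonal then recover `c`, and lifts of radical vectors recover `η`.
  have h2 : ∀ g : U (m + 1 + 1) F,
      radicalChar θ (extendZero c) η g = radicalChar θ (extendZero c') η' g := fun g => by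
    have := congrFun h g
    simp only [h1] at this
    exact mul_left_cancel₀ hne this
  have hcc : c = c' := by
    ext i
    have hinj := AddChar.to_mulShift_inj_of_isPrimitive (AddChar.IsPrimitive.of_ne_one hθ)
    apply hinj
    ext s
    have := h2 (ofSecond (m + 1) (Pi.single i s))
    rw [radicalChar_of_superdiag_eq_zero (superdiag_ofSecond _),
      radicalChar_of_superdiag_eq_zero (superdiag_ofSecond _), levelTwo_ofSecond,
      levelTwo_ofSecond] at this
    simpa [Pi.single_apply, AddChar.mulShift_apply] using this
  subst hcc
  congr 1
  ext r
  have := h2 (ofSuperdiag r.1)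
  have hr : superdiag (ofSuperdiag r.1) ∈ commRadical (m + 1) (extendZero c) := by
    rw [superdiag_ofSuperdiag]; exact r.2
  rw [radicalChar_of_mem hr, radicalChar_of_mem hr, levelTwo_ofSuperdiag, AddChar.map_zero_eq_one,
    one_mul, one_mul] at this
  have hrr : (⟨_, hr⟩ : commRadical (m + 1) (extendZero c)) = r :=
    Subtype.ext (superdiag_ofSuperdiag _)
  rwa [hrr] at this

end Classification

/-! ### Counting sequences by rank, and the resulting polynomial -/

section Counting

variable {F : Type*} [Field F]

/-- The marking of a finite sequence. -/
def marks : (m : ℕ) → (Fin m → F) → ℕ → Prop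
  | 0, _, _ => False
  | m + 1, c, 0 => c 0 ≠ 0 ∧ ¬ marks m (Fin.tail c) 0
  | m + 1, c, i + 1 => marks m (Fin.tail c) i

/-- The second superdiagonal has `m` entries when the first has `m + 1`. The recursion is legitimate
because the mark at an index depends only on later entries. -/
theorem isMarking_marks {m : ℕ} (c : Fin m → F) : IsMarking (m + 1) (extendZero c) (marks m c) := by
  induction m with
  | zero =>
    exact ⟨fun i _ => extendZero_of_le c (Nat.zero_le i), fun i => by
      simp [marks, extendZero_of_le c (Nat.zero_le i)]⟩
  | succ m ih =>
    have hsucc : ∀ i, extendZero c (i + 1) = extendZero (Fin.tail c) i := fun i => by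
      by_cases h : i < m
      · simp [extendZero, h, Fin.tail]
      · rw [extendZero_of_le _ (by omega), extendZero_of_le _ (by omega)]
    refine ⟨fun i hi => extendZero_of_le c (by omega), fun i => ?_⟩
    cases i with
    | zero => rw [show extendZero c 0 = c 0 from extendZero_apply_fin c 0]; rfl
    | succ i => rw [hsucc]; exact (ih (Fin.tail c)).iff i

theorem markCount_succ (n : ℕ) (z : ℕ → Prop) [Decidable (z 0)] :
    markCount (n + 1) z = markCount n (fun i => z (i + 1)) + if z 0 then 1 else 0 := by
  classical
  rw [markCount, markCount, Nat.card_eq_fintype_card, Nat.card_eq_fintype_card,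
    Fintype.card_subtype, Fintype.card_subtype, Fin.card_filter_univ_succ]
  by_cases h : z 0 <;> simp [h]

/-- Half the rank of the alternating form attached to a finite sequence. -/
noncomputable def halfRank {m : ℕ} (c : Fin m → F) : ℕ := markCount (m + 1) (marks m c)

theorem halfRank_zero (c : Fin 0 → F) : halfRank c = 0 := by
  simp [halfRank, markCount, marks]

open Classical in
theorem halfRank_cons {m : ℕ} (a : F) (c : Fin m → F) :
    halfRank (Fin.cons a c : Fin (m + 1) → F) =
      halfRank c + if a ≠ 0 ∧ ¬ marks m c 0 then 1 else 0 := by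
  rw [halfRank, markCount_succ]
  simp only [marks, Fin.tail_cons, Fin.cons_zero]
  rfl

theorem marks_cons_zero {m : ℕ} (a : F) (c : Fin m → F) :
    marks (m + 1) (Fin.cons a c : Fin (m + 1) → F) 0 ↔ a ≠ 0 ∧ ¬ marks m c 0 := by
  simp only [marks, Fin.tail_cons, Fin.cons_zero]

theorem two_mul_halfRank_le {m : ℕ} (c : Fin m → F) : 2 * halfRank c ≤ m + 1 := by
  have := finrank_commRadical (isMarking_marks c)
  change _ + 2 * halfRank c = _ at this
  omega

theorem card_filter_cons {α : Type*} [Fintype α] (m : ℕ) (p : (Fin (m + 1) → α) → Prop)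
    [DecidablePred p] :
    (Finset.univ.filter p).card =
      (Finset.univ.filter fun x : α × (Fin m → α) => p (Fin.cons x.1 x.2)).card := by
  rw [← Fintype.card_subtype, ← Fintype.card_subtype]
  exact (Fintype.card_congr ((Fin.consEquiv fun _ => α).subtypeEquiv fun _ => Iff.rfl)).symm

section Recursion

variable (F) [Fintype F]

open Classical in
/-- The number of sequences of half rank `e` whose first index is not marked. -/
noncomputable def cardUnmarked (m e : ℕ) : ℕ :=
  (Finset.univ.filter fun c : Fin m → F => ¬ marks m c 0 ∧ halfRank c = e).card

open Classical in
/-- The number of sequences of half rank `e` whose first index is marked. -/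
noncomputable def cardMarked (m e : ℕ) : ℕ :=
  (Finset.univ.filter fun c : Fin m → F => marks m c 0 ∧ halfRank c = e).card

open Classical in
theorem card_filter_halfRank (m e : ℕ) :
    (Finset.univ.filter fun c : Fin m → F => halfRank c = e).card =
      cardUnmarked F m e + cardMarked F m e := by
  rw [cardUnmarked, cardMarked, add_comm, ← Finset.card_union_of_disjoint, ← Finset.filter_or]
  · congr 1
    ext c
    simp only [Finset.mem_filter, Finset.mem_univ, true_and]
    tauto
  · rw [Finset.disjoint_filter]
    tauto

theorem cardUnmarked_zero (e : ℕ) : cardUnmarked F 0 e = if e = 0 then 1 else 0 := by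
  classical
  rw [cardUnmarked]
  split_ifs with h
  · subst h; simp [marks, halfRank_zero]
  · rw [Finset.card_eq_zero, Finset.filter_eq_empty_iff]
    intro c _ h'
    rw [halfRank_zero] at h'
    exact h h'.2.symm

theorem cardMarked_zero (e : ℕ) : cardMarked F 0 e = 0 := by
  simp [cardMarked, marks]

theorem cardMarked_succ_zero (m : ℕ) : cardMarked F (m + 1) 0 = 0 := by
  classical
  rw [cardMarked, card_filter_cons, Finset.card_eq_zero, Finset.filter_eq_empty_iff]
  rintro ⟨a, c⟩ _ ⟨h1, h2⟩
  rw [marks_cons_zero] at h1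
  rw [halfRank_cons, if_pos h1] at h2
  omega

/-- A new first index is marked exactly when its entry is nonzero and the old first index is
unmarked. -/
theorem cardMarked_succ_succ (m e : ℕ) :
    cardMarked F (m + 1) (e + 1) = (Fintype.card F - 1) * cardUnmarked F m e := by
  classical
  have h : (Finset.univ.filter fun a : F => a ≠ 0).card = Fintype.card F - 1 := by
    rw [Finset.filter_ne' , Finset.card_erase_of_mem (Finset.mem_univ _), Finset.card_univ]
  rw [cardMarked, card_filter_cons, cardUnmarked, ← h, ← Finset.card_product]
  congr 1
  ext ⟨a, c⟩
  simp only [Finset.mem_filter, Finset.mem_univ, true_and, Finset.mem_product, marks_cons_zero,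
    halfRank_cons]
  constructor
  · rintro ⟨h1, h2⟩
    rw [if_pos h1] at h2
    exact ⟨h1.1, h1.2, by omega⟩
  · rintro ⟨h1, h2, h3⟩
    exact ⟨⟨h1, h2⟩, by rw [if_pos ⟨h1, h2⟩, h3]⟩

/-- Before an unmarked first index only the entry `0` avoids a new mark; before a marked one all `q`
entries do. -/
theorem cardUnmarked_succ (m e : ℕ) :
    cardUnmarked F (m + 1) e = cardUnmarked F m e + Fintype.card F * cardMarked F m e := by
  classical
  have h1 : ∀ s : Finset (Fin m → F), s.card = (({0} : Finset F) ×ˢ s).card := fun s => by simp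
  have h2 : ∀ s : Finset (Fin m → F), Fintype.card F * s.card =
      ((Finset.univ : Finset F) ×ˢ s).card := fun s => by simp
  rw [cardUnmarked, card_filter_cons, cardUnmarked, cardMarked, h1, h2,
    ← Finset.card_union_of_disjoint]
  · congr 1
    ext ⟨a, c⟩
    simp only [Finset.mem_filter, Finset.mem_univ, true_and, Finset.mem_product, marks_cons_zero,
      halfRank_cons, Finset.mem_union, Finset.mem_singleton]
    by_cases ha : a = 0 <;> by_cases hc : marks m c 0 <;> simp [ha, hc]
  · rw [Finset.disjoint_left]
    rintro ⟨a, c⟩ h1 h2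
    simp only [Finset.mem_filter, Finset.mem_univ, true_and, Finset.mem_product] at h1 h2
    exact h1.2.1 h2.1

/-- Together the two recursions give `u (m + 2) (e + 1) = u (m + 1) (e + 1) + q * (q - 1) * u m e`,
which is Pascal's rule along diagonals. -/
theorem cardUnmarked_eq (m e : ℕ) :
    cardUnmarked F m e = (m - e).choose e * (Fintype.card F * (Fintype.card F - 1)) ^ e := by
  induction m using Nat.strong_induction_on generalizing e with
  | _ m ih =>
    match m, e with
    | 0, 0 => simp [cardUnmarked_zero]
    | 0, e + 1 => simp [cardUnmarked_zero]
    | m + 1, 0 =>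
      have h0 : cardMarked F m 0 = 0 := by
        cases m
        · exact cardMarked_zero F 0
        · exact cardMarked_succ_zero F _
      rw [cardUnmarked_succ, ih m (by omega), h0]
      simp
    | 1, e + 1 => simp [cardUnmarked_succ, cardUnmarked_zero, cardMarked_zero]
    | m + 2, e + 1 =>
      rw [cardUnmarked_succ, ih (m + 1) (by omega), cardMarked_succ_succ, ih m (by omega)]
      by_cases hem : e ≤ m
      · have h1 : m + 2 - (e + 1) = (m - e) + 1 := by omega
        have h2 : m + 1 - (e + 1) = m - e := by omega
        rw [h1, h2, Nat.choose_succ_succ, pow_succ]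
        ring
      · rw [Nat.choose_eq_zero_of_lt (by omega : m + 1 - (e + 1) < e + 1),
          Nat.choose_eq_zero_of_lt (by omega : m - e < e),
          Nat.choose_eq_zero_of_lt (by omega : m + 2 - (e + 1) < e + 1)]
        simp

/-- The factor `q ^ (m + 1 - 2 * e)` counts characters of the radical. Writing one factor `q` as `1
+ (q - 1)` and applying Pascal's rule gives the stated shape; when `m + 1 < 2 * e` both sides
vanish, so truncated exponents do no harm. -/
theorem card_halfRank_mul (m e : ℕ) :
    (cardUnmarked F m e + cardMarked F m e) * Fintype.card F ^ (m + 1 - 2 * e) =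
      Fintype.card F ^ (m + 1 - e - 1) * ((m + 1 - e).choose e * (Fintype.card F - 1) ^ e +
        (m + 1 - e - 1).choose e * (Fintype.card F - 1) ^ (e + 1)) := by
  obtain ⟨t, ht⟩ : ∃ t, Fintype.card F = t + 1 := ⟨Fintype.card F - 1, by
    have := Fintype.card_pos (α := F); omega⟩
  rw [cardUnmarked_eq, ht, Nat.add_sub_cancel]
  cases e with
  | zero =>
    have h0 : cardMarked F m 0 = 0 := by
      cases m
      · exact cardMarked_zero F 0
      · exact cardMarked_succ_zero F _
    rw [h0]
    simp [pow_succ]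
    ring
  | succ e =>
    cases m with
    | zero => rw [cardMarked_zero]; simp
    | succ m =>
      rw [cardMarked_succ_succ, cardUnmarked_eq, ht, Nat.add_sub_cancel]
      have h2 : m + 1 - (e + 1) = m - e := by omega
      have h3 : m + 1 + 1 - (e + 1) - 1 = m - e := by omega
      rw [h2, h3]
      by_cases hem : 2 * e ≤ m
      · have h1 : m + 1 + 1 - (e + 1) = (m - e) + 1 := by omega
        have h4 : m + 1 + 1 - 2 * (e + 1) = m - 2 * e := by omega
        have h5 : m - e = (m - 2 * e) + e := by omega
        rw [h1, h4, Nat.choose_succ_succ, show (t + 1) ^ (m - e) =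
          (t + 1) ^ (m - 2 * e) * (t + 1) ^ e by rw [← pow_add, ← h5], mul_pow, mul_pow,
          Nat.succ_eq_add_one]
        ring
      · rw [Nat.choose_eq_zero_of_lt (by omega : m + 1 + 1 - (e + 1) < e + 1),
          Nat.choose_eq_zero_of_lt (by omega : m - e < e),
          Nat.choose_eq_zero_of_lt (by omega : m - e < e + 1)]
        simp

end Recursion

/-- The Heisenberg character of a finite sequence and a linear character of its radical. -/
noncomputable def heisenbergChar {m : ℕ} (θ : AddChar F ℂ)
    (p : Σ c : Fin m → F, AddChar (commRadical (m + 1) (extendZero c)) ℂ) :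
    U (m + 1 + 1) F → ℂ :=
  fun g => (Nat.card F : ℂ) ^ halfRank p.1 * radicalChar θ (extendZero p.1) p.2 g

theorem heisenbergChar_injective [Finite F] {θ : AddChar F ℂ} (hθ : θ ≠ 1) {m : ℕ} :
    Function.Injective (heisenbergChar (m := m) θ) := fun _ _ h => radicalChar_injective hθ h

theorem range_heisenbergChar [Finite F] {θ : AddChar F ℂ} (hθ : θ ≠ 1) (m : ℕ) :
    Set.range (heisenbergChar (m := m) θ) = {χ | IsHeisenberg χ} := by
  ext χ
  constructor
  · rintro ⟨p, rfl⟩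
    exact isHeisenberg_radicalChar hθ (isMarking_marks p.1)
  · intro h
    obtain ⟨c, η, hη⟩ := exists_eq_radicalChar hθ (fun c => ⟨_, isMarking_marks c⟩) h
    exact ⟨⟨c, η⟩, (hη _ (isMarking_marks c)).symm⟩

theorem heisenbergChar_one [Finite F] {θ : AddChar F ℂ} {m : ℕ}
    (p : Σ c : Fin m → F, AddChar (commRadical (m + 1) (extendZero c)) ℂ) :
    heisenbergChar θ p 1 = (Nat.card F : ℂ) ^ halfRank p.1 := by
  rw [heisenbergChar, radicalChar_one, mul_one]

theorem card_addChar_commRadical [Finite F] {m : ℕ} (c : Fin m → F) :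
    Nat.card (AddChar (commRadical (m + 1) (extendZero c)) ℂ) =
      Nat.card F ^ (m + 1 - 2 * halfRank c) := by
  classical
  have := Fintype.ofFinite (commRadical (m + 1) (extendZero c))
  have h := finrank_commRadical (isMarking_marks c)
  change _ + 2 * halfRank c = _ at h
  rw [Nat.card_eq_fintype_card, AddChar.card_eq, ← Nat.card_eq_fintype_card,
    Module.natCard_eq_pow_finrank (K := F), Nat.sub_eq_of_eq_add h.symm]

theorem exists_addChar_ne_one (F : Type*) [Field F] [Finite F] : ∃ θ : AddChar F ℂ, θ ≠ 1 := by
  obtain ⟨ψ, hψ⟩ := AddChar.exists_apply_ne_zero.2 (one_ne_zero : (1 : F) ≠ 0)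
  exact ⟨ψ, fun h => hψ (by rw [h, AddChar.one_apply])⟩

open Classical in
theorem sum_card_addChar_commRadical [Fintype F] (m e : ℕ) :
    ∑ c ∈ Finset.univ.filter (fun c : Fin m → F => halfRank c = e),
        Nat.card (AddChar (commRadical (m + 1) (extendZero c)) ℂ) =
      Nat.card F ^ (m + 1 - e - 1) * ((m + 1 - e).choose e * (Nat.card F - 1) ^ e +
        (m + 1 - e - 1).choose e * (Nat.card F - 1) ^ (e + 1)) := by
  rw [Nat.card_eq_fintype_card (α := F), ← card_halfRank_mul, ← card_filter_halfRank,
    ← smul_eq_mul, ← Finset.sum_const]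
  refine Finset.sum_congr rfl fun c hc => ?_
  rw [card_addChar_commRadical, (Finset.mem_filter.1 hc).2, Nat.card_eq_fintype_card]

theorem encard_image_heisenbergChar [Finite F] {θ : AddChar F ℂ} (hθ : θ ≠ 1) {m : ℕ}
    (s : Finset (Fin m → F)) :
    (heisenbergChar θ '' {p | p.1 ∈ s}).encard =
      ((∑ c ∈ s, Nat.card (AddChar (commRadical (m + 1) (extendZero c)) ℂ) : ℕ) : ℕ∞) := by
  have := fun c : Fin m → F => Fintype.ofFinite (AddChar (commRadical (m + 1) (extendZero c)) ℂ)
  let S : Finset (Σ c : Fin m → F, AddChar (commRadical (m + 1) (extendZero c)) ℂ) :=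
    s.sigma fun _ => Finset.univ
  have hS : {p : Σ c : Fin m → F, AddChar (commRadical (m + 1) (extendZero c)) ℂ | p.1 ∈ s} =
      (S : Set _) := by
    ext p
    simp [S]
  rw [(heisenbergChar_injective hθ).encard_image, hS, Set.encard_coe_eq_coe_finsetCard,
    Finset.card_sigma]
  congr 1
  exact Finset.sum_congr rfl fun c _ => by rw [Finset.card_univ, Nat.card_eq_fintype_card]

theorem encard_heisenberg_degree [Finite F] (m e : ℕ) :
    {χ : U (m + 1 + 1) F → ℂ | IsHeisenberg χ ∧ χ 1 = (Nat.card F : ℂ) ^ e}.encard =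
      ((Nat.card F ^ (m + 1 - e - 1) * ((m + 1 - e).choose e * (Nat.card F - 1) ^ e +
        (m + 1 - e - 1).choose e * (Nat.card F - 1) ^ (e + 1)) : ℕ) : ℕ∞) := by
  classical
  have := Fintype.ofFinite F
  obtain ⟨θ, hθ⟩ := exists_addChar_ne_one F
  rw [← sum_card_addChar_commRadical, ← encard_image_heisenbergChar hθ]
  congr 1
  ext χ
  have hr := Set.ext_iff.1 (range_heisenbergChar hθ m) χ
  have hpow : Function.Injective fun k : ℕ => (Nat.card F : ℂ) ^ k := by
    intro a b hab
    have hab' : ((Nat.card F ^ a : ℕ) : ℂ) = (Nat.card F ^ b : ℕ) := by push_cast; exact hab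
    exact Nat.pow_right_injective Finite.one_lt_card (by exact_mod_cast hab')
  constructor
  · rintro ⟨h1, h2⟩
    obtain ⟨p, rfl⟩ := hr.2 h1
    rw [heisenbergChar_one] at h2
    exact ⟨p, Finset.mem_filter.2 ⟨Finset.mem_univ _, hpow h2⟩, rfl⟩
  · rintro ⟨p, hp, rfl⟩
    exact ⟨hr.1 ⟨p, rfl⟩, by rw [heisenbergChar_one, (Finset.mem_filter.1 hp).2]⟩

/-- Since twice the half rank is at most `m + 1`, the range of summation meets every fibre. -/
theorem encard_heisenberg [Finite F] (m : ℕ) :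
    {χ : U (m + 1 + 1) F → ℂ | IsHeisenberg χ}.encard =
      ((∑ e ∈ Finset.range (m + 1),
        Nat.card F ^ (m + 1 - e - 1) * ((m + 1 - e).choose e * (Nat.card F - 1) ^ e +
          (m + 1 - e - 1).choose e * (Nat.card F - 1) ^ (e + 1)) : ℕ) : ℕ∞) := by
  classical
  have := Fintype.ofFinite F
  obtain ⟨θ, hθ⟩ := exists_addChar_ne_one F
  rw [Finset.sum_congr rfl fun e _ => (sum_card_addChar_commRadical (F := F) m e).symm,
    Finset.sum_fiberwise_of_maps_to fun c _ => Finset.mem_range.2 (by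
      have := two_mul_halfRank_le (F := F) c
      omega), ← encard_image_heisenbergChar hθ, ← range_heisenbergChar hθ m, ← Set.image_univ]
  simp

/-- The polynomial that counts Heisenberg characters. -/
noncomputable def countPoly (m : ℕ) : ℕ[X] :=
  ∑ e ∈ Finset.range (m + 1), ((m + 1 - e).choose e • ((X + 1) ^ (m - e) * X ^ e) +
    (m - e).choose e • ((X + 1) ^ (m - e) * X ^ (e + 1)))

theorem eval_countPoly (m q : ℕ) (hq : 1 ≤ q) : (countPoly m).eval (q - 1) =
    ∑ e ∈ Finset.range (m + 1),
        q ^ (m + 1 - e - 1) * ((m + 1 - e).choose e * (q - 1) ^ e +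
          (m + 1 - e - 1).choose e * (q - 1) ^ (e + 1)) := by
  rw [countPoly, eval_finsetSum]
  refine Finset.sum_congr rfl fun e _ => ?_
  have h : m + 1 - e - 1 = m - e := by omega
  simp only [eval_add, eval_smul, eval_mul, eval_pow, eval_X, eval_one, Nat.sub_add_cancel hq, h,
    smul_eq_mul]
  ring

/-- In each summand the first product has degree `m` and the second is monic of degree `m + 1`, so
the coefficient is `∑ (m - e).choose e`, the Fibonacci number as a diagonal sum. -/
theorem coeff_countPoly (m : ℕ) : (countPoly m).coeff (m + 1) = Nat.fib (m + 1) := by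
  have hX : (X + 1 : ℕ[X]).Monic := monic_X_add_C 1
  have hX' : (X + 1 : ℕ[X]).natDegree = 1 := natDegree_X_add_C 1
  have hmon : ∀ k j : ℕ, ((X + 1 : ℕ[X]) ^ k * X ^ j).Monic := fun k j =>
    (hX.pow k).mul (monic_X_pow j)
  have hdeg : ∀ k j : ℕ, ((X + 1 : ℕ[X]) ^ k * X ^ j).natDegree = k + j := fun k j => by
    rw [(hX.pow k).natDegree_mul (monic_X_pow j), natDegree_X_pow, hX.natDegree_pow, hX', mul_one]
  rw [Nat.fib_succ_eq_sum_choose, ← Finset.Nat.sum_antidiagonal_swap,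
    Finset.Nat.sum_antidiagonal_eq_sum_range_succ_mk, countPoly, finsetSum_coeff]
  refine Finset.sum_congr rfl fun e he => ?_
  have he' : e ≤ m := Nat.lt_succ_iff.1 (Finset.mem_range.1 he)
  have h1 : ((X + 1 : ℕ[X]) ^ (m - e) * X ^ e).coeff (m + 1) = 0 :=
    coeff_eq_zero_of_natDegree_lt (by rw [hdeg]; omega)
  have h2 : ((X + 1 : ℕ[X]) ^ (m - e) * X ^ (e + 1)).coeff (m + 1) = 1 := by
    have := (hmon (m - e) (e + 1)).coeff_natDegree
    rwa [hdeg, show m - e + (e + 1) = m + 1 by omega] at this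
  rw [coeff_add, coeff_smul, coeff_smul, h1, h2]
  simp

theorem natDegree_countPoly (m : ℕ) : (countPoly m).natDegree = m + 1 := by
  refine le_antisymm ?_ (le_natDegree_of_ne_zero ?_)
  · refine natDegree_sum_le_of_forall_le _ _ fun e he => ?_
    have he' : e ≤ m := Nat.lt_succ_iff.1 (Finset.mem_range.1 he)
    have hX : ((X : ℕ[X]) + 1).natDegree ≤ 1 := natDegree_X_add_C (1 : ℕ) ▸ le_rfl
    have hb : ∀ j, j ≤ e + 1 → ((X + 1 : ℕ[X]) ^ (m - e) * X ^ j).natDegree ≤ m + 1 := fun j hj =>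
      natDegree_mul_le.trans (by
        have h1 := natDegree_pow_le_of_le (m - e) hX
        have h2 := natDegree_X_pow (R := ℕ) j
        omega)
    exact natDegree_add_le_of_degree_le ((natDegree_smul_le _ _).trans (hb e (by omega)))
      ((natDegree_smul_le _ _).trans (hb _ le_rfl))
  · rw [coeff_countPoly]
    exact (Nat.fib_pos.2 (Nat.succ_pos m)).ne'

end Counting

/-! ### The subalgebra and the induced character of a functional on two superdiagonals -/

section Induced

variable {F : Type*} [Field F] {n : ℕ}

/-- The superdiagonal of a strictly upper triangular matrix. -/
def nilSuperdiag (n : ℕ) (F : Type*) [Field F] : nilU (n + 1) F →ₗ[F] (Fin n → F) :=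
  LinearMap.pi fun i => eStar i (i + 1)

theorem extendZero_nilSuperdiag (X : nilU (n + 1) F) (i : ℕ) :
    extendZero (nilSuperdiag n F X) i = eStar i (i + 1) X := by
  obtain ⟨g, rfl⟩ := subOne_surjective X
  exact extendZero_superdiag g i

theorem exists_nilSuperdiag_eq (r : Fin n → F) : ∃ X, nilSuperdiag n F X = r :=
  ⟨subOne (ofSuperdiag r), superdiag_ofSuperdiag r⟩

/-- The functional `∑ aᵢ e*ᵢ,ᵢ₊₁ + ∑ cᵢ e*ᵢ,ᵢ₊₂`. -/
def bandFunctional (n : ℕ) (a c : ℕ → F) : nilU (n + 1) F →ₗ[F] F :=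
  ∑ i ∈ Finset.range n, (a i • eStar i (i + 1) + c i • eStar i (i + 2))

theorem bandFunctional_apply (a c : ℕ → F) (X : nilU (n + 1) F) :
    bandFunctional n a c X =
      ∑ i ∈ Finset.range n, (a i * eStar i (i + 1) X + c i * eStar i (i + 2) X) := by
  simp [bandFunctional]

theorem bandFunctional_subOne (a c : ℕ → F) (g : U (n + 1) F) :
    bandFunctional n a c (subOne g) =
      ∑ i ∈ Finset.range n, a i * extendZero (superdiag g) i + levelTwo c g := by
  rw [bandFunctional_apply, Finset.sum_add_distrib, levelTwo]
  simp only [extendZero_superdiag]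
  rfl

theorem bandFunctional_mul (a c : ℕ → F) (X Y : nilU (n + 1) F) :
    bandFunctional n a c (X * Y) = shiftForm n c (nilSuperdiag n F X) (nilSuperdiag n F Y) := by
  rw [bandFunctional_apply, shiftForm_apply]
  refine Finset.sum_congr rfl fun i _ => ?_
  rw [extendZero_nilSuperdiag, extendZero_nilSuperdiag, eStar_mul_one, eStar_mul_two]
  ring

section Radicals

variable {a c : ℕ → F} {z : ℕ → Prop}

theorem mem_orthoIn_bandFunctional {S T : Submodule F (nilU (n + 1) F)} {X : nilU (n + 1) F} :
    X ∈ orthoIn (bandFunctional n a c) S T ↔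
      X ∈ S ∧ ∀ Y ∈ T, shiftForm n c (nilSuperdiag n F X) (nilSuperdiag n F Y) = 0 := by
  simp only [← bandFunctional_mul a c]
  rfl

/-- The two inclusions feed each other: basis vectors at `i + 1`, for `i` marked, lie in `𝔰ʲ` and
test that `𝔩ʲ⁺¹` vanishes at `i`; then `𝔩ʲ⁺¹` is orthogonal to the unmarked subspace. -/
theorem unmarked_le_sSeq_and_lSeq_le_unmarked (hz : IsMarking n c z) (j : ℕ) :
    (unmarked F n z).comap (nilSuperdiag n F) ≤ sSeq (bandFunctional n a c) j ∧
      lSeq (bandFunctional n a c) j ≤ (unmarked F n z).comap (nilSuperdiag n F) := by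
  induction j with
  | zero => exact ⟨le_top, bot_le⟩
  | succ j ih =>
    have hl : lSeq (bandFunctional n a c) (j + 1) ≤
        (unmarked F n z).comap (nilSuperdiag n F) := by
      intro X hX
      rw [lSeq, mem_orthoIn_bandFunctional] at hX
      rw [Submodule.mem_comap, mem_unmarked_iff_extendZero]
      intro i hi
      obtain ⟨hc, hni⟩ := (hz.iff i).1 hi
      obtain ⟨Y, hY⟩ := exists_nilSuperdiag_eq (Pi.single ⟨i + 1, hz.lt hi⟩ (1 : F))
      have h0 := hX.2 Y (ih.1 (by
        rw [Submodule.mem_comap, hY]; exact single_mem_unmarked _ hni))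
      rw [hY, shiftForm_single_right] at h0
      exact (mul_eq_zero.1 h0).resolve_left hc
    refine ⟨fun X hX => ?_, hl⟩
    rw [sSeq, mem_orthoIn_bandFunctional]
    exact ⟨ih.1 hX, fun Y hY => shiftForm_eq_zero hz hX (hl hY)⟩

/-- Elements of `𝔰ʲ` vanish at marked indices among the last `j`. For marked `i`, the basis vector
at `i + 1` enters `𝔩ʲ⁺¹`, because `𝔰ʲ` already vanishes at `i + 2` or `cᵢ₊₁ = 0`; this kills index
`i` in `𝔰ʲ⁺¹`. -/
theorem extendZero_eq_zero_of_mem_sSeq (hz : IsMarking n c z) (j : ℕ) {X : nilU (n + 1) F}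
    (hX : X ∈ sSeq (bandFunctional n a c) j) {i : ℕ} (hi : z i) (hij : n ≤ i + j) :
    extendZero (nilSuperdiag n F X) i = 0 := by
  induction j generalizing X i with
  | zero => exact extendZero_of_le _ hij
  | succ j ih =>
    obtain ⟨hc, hni⟩ := (hz.iff i).1 hi
    obtain ⟨Y, hY⟩ := exists_nilSuperdiag_eq (Pi.single ⟨i + 1, hz.lt hi⟩ (1 : F))
    have hYl : Y ∈ orthoIn (bandFunctional n a c) (sSeq (bandFunctional n a c) j)
        (sSeq (bandFunctional n a c) j) := by
      rw [mem_orthoIn_bandFunctional]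
      refine ⟨(unmarked_le_sSeq_and_lSeq_le_unmarked hz j).1 (by
        rw [Submodule.mem_comap, hY]; exact single_mem_unmarked _ hni), fun Y' hY' => ?_⟩
      rw [hY, shiftForm_single_left]
      by_cases hc' : c (i + 1) = 0
      · rw [hc', zero_mul]
      · rw [ih hY' ((hz.or hc').resolve_left hni) (by omega), mul_zero]
    rw [sSeq, mem_orthoIn_bandFunctional] at hX
    have h0 := hX.2 Y hYl
    rw [hY, shiftForm_single_right] at h0
    exact (mul_eq_zero.1 h0).resolve_left hc

theorem lBar_bandFunctional (hz : IsMarking n c z) :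
    lBar (bandFunctional n a c) = (unmarked F n z).comap (nilSuperdiag n F) := by
  refine le_antisymm (iSup_le fun j => (unmarked_le_sSeq_and_lSeq_le_unmarked hz j).2) ?_
  -- By stage `n` the space `𝔰ⁿ` vanishes at all marked indices, so `𝔩ⁿ⁺¹` contains the whole
  -- unmarked preimage.
  refine le_trans (fun X hX => ?_) (le_iSup _ (n + 1))
  rw [lSeq, mem_orthoIn_bandFunctional]
  refine ⟨(unmarked_le_sSeq_and_lSeq_le_unmarked hz n).1 hX, fun Y hY =>
    shiftForm_eq_zero hz hX (mem_unmarked_iff_extendZero.2 fun i hi => ?_)⟩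
  exact extendZero_eq_zero_of_mem_sSeq hz n hY hi (by omega)

theorem LBar_bandFunctional [Finite F] (hz : IsMarking n c z) :
    LBar (bandFunctional n a c) = superdiagComap (unmarked F n z) := by
  ext g
  change subOne g ∈ lBar _ ↔ _
  rw [lBar_bandFunctional hz]
  rfl

/-- The linear character of the radical given by a functional of the superdiagonal. -/
def superdiagChar (θ : AddChar F ℂ) (a c : ℕ → F) : AddChar (commRadical n c) ℂ where
  toFun r := θ (∑ i ∈ Finset.range n, a i * extendZero r.1 i)
  map_zero_eq_one' := by simp
  map_add_eq_mul' r s := by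
    rw [← AddChar.map_add_eq_mul, ← Finset.sum_add_distrib]
    simp [mul_add]

theorem bandFunctional_conj (g x : U (n + 1) F) :
    bandFunctional n a c (subOne (x * g * x⁻¹)) =
      bandFunctional n a c (subOne g) + commForm n c (superdiag x) (superdiag g) := by
  rw [bandFunctional_subOne, bandFunctional_subOne, superdiag_conj, conj_eq_commutator_mul,
    levelTwo_mul, levelTwo_commutator, superdiag_commutator, map_zero, LinearMap.zero_apply]
  ring

/-- Translating the summation variable by a suitable `h` multiplies the sum by `θ t ≠ 1`. -/
theorem sum_commForm [Fintype (U (n + 1) F)] {θ : AddChar F ℂ} (hθ : θ ≠ 1) {g : U (n + 1) F}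
    (hg : superdiag g ∉ commRadical n c) :
    ∑ x : U (n + 1) F, θ (commForm n c (superdiag x) (superdiag g)) = 0 := by
  rw [mem_commRadical] at hg
  push Not at hg
  obtain ⟨y, hy⟩ := hg
  obtain ⟨t, ht⟩ := AddChar.ne_one_iff.1 hθ
  set h : U (n + 1) F := ofSuperdiag ((t / commForm n c y (superdiag g)) • y) with hh
  have hval : commForm n c (superdiag h) (superdiag g) = t := by
    rw [hh, superdiag_ofSuperdiag, map_smul, LinearMap.smul_apply, smul_eq_mul,
      div_mul_cancel₀ _ hy]
  have hs := Equiv.sum_comp (Equiv.mulLeft h)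
    fun x => θ (commForm n c (superdiag x) (superdiag g))
  simp only [Equiv.coe_mulLeft, superdiag_mul, map_add, LinearMap.add_apply, hval,
    AddChar.map_add_eq_mul, ← Finset.mul_sum] at hs
  have h0 : (θ t - 1) * ∑ x : U (n + 1) F, θ (commForm n c (superdiag x) (superdiag g)) = 0 := by
    rw [sub_mul, hs, one_mul, sub_self]
  exact (mul_eq_zero.1 h0).resolve_left (sub_ne_zero.2 ht)

/-- The subgroup depends only on the superdiagonal, which conjugation fixes, and conjugating by `x`
multiplies the linear character by `θ` of a pairing with `x`. The sum over `x` is therefore zero off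
the radical; on it, every term is equal and the index `q ^ markCount n z` remains. -/
theorem xi_bandFunctional [Finite F] {θ : AddChar F ℂ} (hθ : θ ≠ 1) (hz : IsMarking n c z) :
    xi θ (bandFunctional n a c) = fun g : U (n + 1) F =>
      (Nat.card F : ℂ) ^ markCount n z * radicalChar θ c (superdiagChar θ a c) g := by
  classical
  have := Fintype.ofFinite (U (n + 1) F)
  funext g
  have hmem : ∀ x : U (n + 1) F, x * g * x⁻¹ ∈ superdiagComap (unmarked F n z) ↔
      superdiag g ∈ unmarked F n z := fun x => by rw [mem_superdiagComap, superdiag_conj]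
  rw [xi, inducedCharacter, LBar_bandFunctional hz, finsum_eq_sum_of_fintype]
  simp only [hmem, thetaFun, bandFunctional_conj]
  by_cases hg : superdiag g ∈ commRadical n c
  · have hL : (Nat.card (superdiagComap (unmarked F n z)) : ℂ) ≠ 0 := by
      exact_mod_cast Nat.card_pos.ne'
    have hi := index_superdiagComap (unmarked F n z) (finrank_unmarked z)
    have hc := (superdiagComap (unmarked F n z)).index_mul_card
    rw [hi] at hc
    simp only [if_pos (commRadical_le_unmarked hz hg), mem_commRadical.1 hg, add_zero,
      Finset.sum_const, Finset.card_univ, nsmul_eq_mul]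
    rw [← Nat.card_eq_fintype_card, ← hc, radicalChar_of_mem hg, bandFunctional_subOne,
      AddChar.map_add_eq_mul, inv_mul_eq_iff_eq_mul₀ hL]
    push_cast
    change _ = _ * ((Nat.card F : ℂ) ^ Nat.card {i : Fin n // z i} * (_ *
      θ (∑ i ∈ Finset.range n, a i * extendZero (superdiag g) i)))
    ring
  · rw [radicalChar_of_notMem hg]
    simp only [AddChar.map_add_eq_mul]
    split_ifs
    · rw [← Finset.mul_sum, sum_commForm hθ hg]; simp
    · simp

end Radicals

end Induced

/-! ### The vector and the marking of a labelled path -/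

section Paths

variable {F : Type*} [Field F] {n : ℕ}

theorem bandFunctional_add (a a' c c' : ℕ → F) :
    bandFunctional n (a + a') (c + c') = bandFunctional n a c + bandFunctional n a' c' := by
  ext X
  rw [LinearMap.add_apply, bandFunctional_apply, bandFunctional_apply, bandFunctional_apply,
    ← Finset.sum_add_distrib]
  refine Finset.sum_congr rfl fun i _ => ?_
  simp only [Pi.add_apply]
  ring

theorem bandFunctional_single_left {d : ℕ} (hd : d < n) (t : F) :
    bandFunctional n (Pi.single d t) 0 = t • eStar d (d + 1) := by
  rw [bandFunctional, Finset.sum_eq_single d]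
  · simp
  · intro j _ hj; simp [hj]
  · simp [hd]

theorem bandFunctional_single_right {d : ℕ} (hd : d < n) (t : F) :
    bandFunctional n 0 (Pi.single d t) = t • eStar d (d + 2) := by
  rw [bandFunctional, Finset.sum_eq_single d]
  · simp
  · intro j _ hj; simp [hj]
  · simp [hd]

theorem markCount_insert {z : ℕ → Prop} {d : ℕ} (hd : d < n) (h : ¬ z d) :
    markCount n (fun i => z i ∨ i = d) = markCount n z + 1 := by
  classical
  rw [markCount, markCount, Nat.card_eq_fintype_card, Nat.card_eq_fintype_card,
    Fintype.card_subtype, Fintype.card_subtype,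
    ← Finset.card_insert_of_notMem (a := (⟨d, hd⟩ : Fin n)) (by simpa using h)]
  congr 1
  ext i
  simp only [Finset.mem_filter, Finset.mem_univ, true_and, Finset.mem_insert, Fin.ext_iff]
  tauto

/-- Adding entries in the positions `d` and possibly `d - 1` in front of a sequence that starts with
an unmarked position `d + 1` marks the position `d`. -/
theorem IsMarking.insert {c u : ℕ → F} {z : ℕ → Prop} {d : ℕ} (hz : IsMarking n c z)
    (hd : d + 2 ≤ n) (hc : ∀ i, i ≤ d → c i = 0) (hzd : ¬ z (d + 1)) (hu : u d ≠ 0)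
    (hu' : ∀ i, i ≠ d → i + 1 ≠ d → u i = 0) : IsMarking n (c + u) fun i => z i ∨ i = d := by
  have hz0 : ∀ i, i ≤ d → ¬ z i := fun i hi h => ((hz.iff i).1 h).1 (hc i hi)
  constructor
  · intro i hi
    rw [Pi.add_apply, hz.support i hi, hu' i (by omega) (by omega), add_zero]
  · intro i
    rw [Pi.add_apply]
    by_cases h1 : i = d
    · subst h1
      rw [hc i le_rfl, zero_add]
      simp [hu, hzd]
    · by_cases h2 : i + 1 = d
      · have := hz0 i (by omega)
        simp [h1, h2, this]
      · rw [hu' i h1 h2, add_zero, hz.iff i]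
        simp [h1, h2]

/-- Build the path from its end. A step `(0,2)` reaches back to index `d - 1`, so the entry there
may be nonzero; the invariant is that this index is nevertheless unmarked, which lets a preceding
step `(1,1)` or `(0,2)` add exactly one mark. -/
theorem exists_band_of_path (P : List (Step F)) (d : ℕ)
    (hd : d + ((endpoint P).1 + (endpoint P).2) = n)
    (hP : d = 0 → ∀ t v, P.head? ≠ some (Step.upup t v)) :
    ∃ (a c : ℕ → F) (z : ℕ → Prop), functionalFrom d P = bandFunctional n a c ∧ IsMarking n c z ∧
      (∀ i, i + 1 < d → c i = 0) ∧ (∀ i, i + 1 = d → ¬ z i) ∧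
      markCount n z = P.countP Step.isDiag + P.countP Step.isUpup := by
  induction P generalizing d with
  | nil =>
    refine ⟨0, 0, fun _ => False, ?_, ⟨fun _ _ => rfl, fun i => by simp⟩, fun _ _ => rfl,
      fun _ _ => id, by simp [markCount]⟩
    simp [functionalFrom, bandFunctional]
  | cons s P ih =>
    have he : (endpoint (s :: P)).1 + (endpoint (s :: P)).2 =
        (s.vec.1 + s.vec.2) + ((endpoint P).1 + (endpoint P).2) := by
      simp only [endpoint, List.map_cons, List.sum_cons, Prod.fst_add, Prod.snd_add]
      omega
    rw [he, ← add_assoc] at hd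
    have hs : 0 < s.vec.1 + s.vec.2 := by cases s <;> simp [Step.vec]
    obtain ⟨a, c, z, h1, h2, h3, h4, h5⟩ := ih _ hd (fun h => by omega)
    cases s with
    | right =>
      refine ⟨a, c, z, ?_, h2, fun i hi => h3 i (by simp [Step.vec]; omega), fun i hi hzi => ?_, ?_⟩
      · rw [functionalFrom, h1, stepFunctional, zero_add]
      · exact ((h2.iff i).1 hzi).1 (h3 i (by simp [Step.vec]; omega))
      · simpa [Step.isDiag, Step.isUpup] using h5
    | up t =>
      simp only [Step.vec] at hd h3
      refine ⟨Pi.single d t.1 + a, 0 + c, z, ?_, by rwa [zero_add],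
        fun i hi => by rw [zero_add]; exact h3 i (by omega), fun i hi hzi => ?_, ?_⟩
      · rw [functionalFrom, h1, stepFunctional, bandFunctional_add,
          bandFunctional_single_left (by omega)]
      · exact ((h2.iff i).1 hzi).1 (h3 i (by omega))
      · simpa [Step.isDiag, Step.isUpup] using h5
    | diag t =>
      simp only [Step.vec] at hd h3 h4
      have hc : ∀ i, i ≤ d → c i = 0 := fun i hi => h3 i (by omega)
      have hzd : ¬ z d := fun h => ((h2.iff d).1 h).1 (hc d le_rfl)
      refine ⟨a + 0, c + Pi.single d t.1, _, ?_,
        h2.insert (by omega) hc (h4 _ (by omega)) (by simp) (fun i hi _ => by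
          simp [hi]), fun i hi => ?_, fun i hi => ?_, ?_⟩
      · rw [functionalFrom, h1, stepFunctional, bandFunctional_add,
          bandFunctional_single_right (by omega)]
        exact add_comm _ _
      · rw [Pi.add_apply, hc i (by omega), zero_add, Pi.single_apply, if_neg (by omega)]
      · rintro (h | h)
        · exact ((h2.iff i).1 h).1 (hc i (by omega))
        · omega
      · rw [markCount_insert (by omega) hzd, h5]
        rw [List.countP_cons_of_pos rfl, List.countP_cons_of_neg (by simp [Step.isUpup])]
        omega
    | upup t v =>
      simp only [Step.vec] at hd h3 h4
      have hc : ∀ i, i ≤ d → c i = 0 := fun i hi => h3 i (by omega)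
      have hzd : ¬ z d := fun h => ((h2.iff d).1 h).1 (hc d le_rfl)
      -- A step `(0,2)` cannot start at `d = 0`, so the row `d - 1` exists. The larger of its two
      -- new indices gets the mark, which leaves the smaller one unmarked.
      obtain ⟨d, rfl⟩ : ∃ d', d = d' + 1 := Nat.exists_eq_succ_of_ne_zero fun h => hP h t v rfl
      refine ⟨a + (0 + 0), c + (Pi.single d t.1 + Pi.single (d + 1) v.1), _, ?_,
        h2.insert (by omega) hc (h4 _ (by omega)) (by simp) (fun i hi hi' => by
          have : i ≠ d := by omega
          simp [hi, this]), fun i hi => ?_, fun i hi => ?_, ?_⟩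
      · rw [functionalFrom, h1, stepFunctional, bandFunctional_add, bandFunctional_add,
          bandFunctional_single_right (by omega), bandFunctional_single_right (by omega)]
        exact add_comm _ _
      · rw [Pi.add_apply, Pi.add_apply, hc i (by omega), zero_add, Pi.single_apply,
          Pi.single_apply, if_neg (by omega), if_neg (by omega), add_zero]
      · rintro (h | h)
        · exact ((h2.iff i).1 h).1 (hc i (by omega))
        · omega
      · rw [markCount_insert (by omega) hzd, h5]
        rw [List.countP_cons_of_neg (by simp [Step.isDiag]), List.countP_cons_of_pos rfl]
        omega

theorem xiPath_isHeisenberg [Finite F] {θ : AddChar F ℂ} (hθ : θ ≠ 1) {P : List (Step F)}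
    (hP : P ∈ HeisPaths n F) : IsHeisenberg (xiPath (n + 1) θ P) ∧
      xiPath (n + 1) θ P 1 =
        (Nat.card F : ℂ) ^ (P.countP Step.isDiag + P.countP Step.isUpup) := by
  obtain ⟨a, c, z, h1, h2, -, -, h5⟩ := exists_band_of_path P 0 (by rw [zero_add, hP.1])
    fun _ => hP.2
  rw [xiPath, pathFunctional, h1, xi_bandFunctional hθ h2]
  exact ⟨isHeisenberg_radicalChar hθ h2, by
    beta_reduce
    rw [radicalChar_one, mul_one, h5]⟩

end Paths

end HeisenbergUnitriangular

theorem theorem2 :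
    -- the number of Heisenberg characters of degree `q ^ e`
    (∀ (n : ℕ), 1 ≤ n → ∀ (e : ℕ) (F : Type u) [Field F] [Finite F],
      {χ : HeisenbergUnitriangular.U (n + 1) F → ℂ |
          HeisenbergUnitriangular.IsHeisenberg χ ∧ χ 1 = (Nat.card F : ℂ) ^ e}.encard =
        ((Nat.card F ^ (n - e - 1) *
          ((n - e).choose e * (Nat.card F - 1) ^ e +
            (n - e - 1).choose e * (Nat.card F - 1) ^ (e + 1)) : ℕ) : ℕ∞)) ∧
    -- the Heisenberg character of a labelled lattice path, and its degree
    (∀ (n : ℕ) (F : Type u) [Field F] [Finite F] (θ : AddChar F ℂ), θ ≠ 1 →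
      ∀ P ∈ HeisenbergUnitriangular.HeisPaths n F,
        HeisenbergUnitriangular.IsHeisenberg (HeisenbergUnitriangular.xiPath (n + 1) θ P) ∧
        HeisenbergUnitriangular.xiPath (n + 1) θ P 1 =
          (Nat.card F : ℂ) ^ (P.countP HeisenbergUnitriangular.Step.isDiag +
            P.countP HeisenbergUnitriangular.Step.isUpup)) ∧
    -- the number of all Heisenberg characters
    (∀ (n : ℕ), 1 ≤ n → ∃ p : ℕ[X], p.natDegree = n ∧ p.leadingCoeff = Nat.fib n ∧
      ∀ (F : Type u) [Field F] [Finite F],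
        {χ : HeisenbergUnitriangular.U (n + 1) F → ℂ |
          HeisenbergUnitriangular.IsHeisenberg χ}.encard =
            ((p.eval (Nat.card F - 1) : ℕ) : ℕ∞)) := by
  refine ⟨fun n hn e F _ _ => ?_, fun n F _ _ θ hθ P hP => ?_, fun n hn => ?_⟩
  · obtain ⟨m, rfl⟩ := Nat.exists_eq_add_of_le' hn
    exact HeisenbergUnitriangular.encard_heisenberg_degree m e
  · exact HeisenbergUnitriangular.xiPath_isHeisenberg hθ hP
  · obtain ⟨m, rfl⟩ := Nat.exists_eq_add_of_le' hn
    refine ⟨HeisenbergUnitriangular.countPoly m, HeisenbergUnitriangular.natDegree_countPoly m, ?_,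
      fun F _ _ => ?_⟩
    · rw [leadingCoeff, HeisenbergUnitriangular.natDegree_countPoly,
        HeisenbergUnitriangular.coeff_countPoly]
    · rw [HeisenbergUnitriangular.encard_heisenberg,
        HeisenbergUnitriangular.eval_countPoly m _ Finite.one_lt_card.le]
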